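/- Consider a multi-code CDMA system with $K$ users, processing gain $N\ge 1$ and noise variance $\sigma^2>0$. User $k$ has power $p_k>0$ and may use at most $\bar n_k\ge 1$ data streams, and the users are numbered so that $p_1/\bar n_1\ge p_2/\bar n_2\ge\cdots\ge p_K/\bar n_K$. A system is a choice, for each user $k$, of a real $N\times\bar n_k$ signature matrix $S_k$ (whose columns $s_{k,1},\dots,s_{k,\bar n_k}$ are the signature sequences) and of a positive semidefinite $\bar n_k\times\bar n_k$ data-correlation matrix $P_k$ with $\frac1N\operatorname{tr}(S_kP_kS_k^T)=p_k$. Its sum rate is $\frac1{2N}\log_2\det\bigl(I_N+\frac1{\sigma^2}\sum_{k=1}^K S_kP_kS_k^T\bigr)$, and it is sum-rate-optimal if no such system has a larger sum rate. The signature sequence $s_{k,l}$ is active if $(P_k)_{l,l}>0$; it is an active orthogonal sequence if moreover it is nonzero and orthogonal to every other active signature sequence of the system (of any user). Let $n_k$ be the number of active, and $n_k^\perp$ the number of active orthogonal, signature sequences of user $k$. Let $K_2$ be the number of users $k$ that are non-undersized, i.e. satisfy $$\Bigl(N-\sum_{k'=1}^{k-1}\bar n_{k'}\Bigr)\frac{p_k}{\sum_{k'=k}^{K}p_{k'}}\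 \ge\ \bar n_k ,$$ (these are the users $k\le K_2$; the users $k>K_2$ are called undersized), and for $k>K_2$ put $$x_k=\Bigl(N-\sum_{k'=1}^{K_2}\bar n_{k'}\Bigr)\frac{p_k}{\sum_{k'=K_2+1}^{K}p_{k'}} .$$ Then, for each user $k$, the minimum of $n_k$ over all sum-rate-optimal systems exists and equals $\bar n_k$ if $k\le K_2$, and $\lceil x_k\rceil$ if $k>K_2$. The maximum of $n_k^\perp$ over all sum-rate-optimal systems exists and equals $\bar n_k$ if $k\le K_2$, and $\lfloor x_k\rfloor$ if $k>K_2$. All these minima and maxima, for all users at once, are attained by a single sum-rate-optimal system, which can be taken with every $P_k$ diagonal and every signature sequence satisfying $\|s_{k,l}\|^2=N$. -/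

import Mathlib

/-- A choice of the decision parameters of a multi-code CDMA system with `K` users, processing gain
`N` and at most `nbar k` data streams for user `k` (users are indexed from `0`): the signature
matrix `S_k`, whose `l`-th column is the signature sequence of the `l`-th stream of user `k`, and
the correlation matrix `P_k = E[d_k d_kᵀ]` of the data symbols of user `k`. A stream is left unused
by giving its data symbol zero power. -/
structure CDMASystem {K : ℕ} (N : ℕ) (nbar : Fin K → ℕ) where
  sig : ∀ k : Fin K, Matrix (Fin N) (Fin (nbar k)) ℝ
  corr : ∀ k : Fin K, Matrix (Fin (nbar k)) (Fin (nbar k)) ℝ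

namespace CDMASystem

variable {K N : ℕ} {nbar : Fin K → ℕ}

/-- The matrix `S = [S_1, …, S_K]`. -/
def sigMatrix (X : CDMASystem N nbar) : Matrix (Fin N) (Σ k : Fin K, Fin (nbar k)) ℝ :=
  Matrix.of fun i j => X.sig j.1 i j.2

/-- The matrix `P = diag(P_1, …, P_K)`. -/
def corrMatrix (X : CDMASystem N nbar) :
    Matrix (Σ k : Fin K, Fin (nbar k)) (Σ k : Fin K, Fin (nbar k)) ℝ :=
  Matrix.blockDiagonal' X.corr

/-- The sum rate `(1 / 2N) log₂ det (I + σ⁻² S P Sᵀ)` in bits per chip. -/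
noncomputable def sumRate (σ : ℝ) (X : CDMASystem N nbar) : ℝ :=
  1 / (2 * (N : ℝ)) *
    Real.logb 2
      (1 + (1 / σ ^ 2) • (X.sigMatrix * X.corrMatrix * X.sigMatrix.transpose)).det

/-- `X` is feasible for the power profile `p`: each `P_k` is a correlation matrix and
`(1/N) tr (S_k P_k S_kᵀ) = p_k`. -/
def IsFeasible (p : Fin K → ℝ) (X : CDMASystem N nbar) : Prop :=
  ∀ k, (X.corr k).PosSemidef ∧
    1 / (N : ℝ) * (X.sig k * X.corr k * (X.sig k).transpose).trace = p k

/-- `X` is feasible and attains the maximum sum rate among all feasible systems. -/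
def IsSumRateOptimal (p : Fin K → ℝ) (σ : ℝ) (X : CDMASystem N nbar) : Prop :=
  X.IsFeasible p ∧ ∀ Y : CDMASystem N nbar, Y.IsFeasible p → Y.sumRate σ ≤ X.sumRate σ

/-- `X` is in normalized form: the data symbols are uncorrelated and every signature sequence has
energy `N`. The diagonal entries of `P_k` are then the powers of the streams of user `k`. -/
def IsNormalized (X : CDMASystem N nbar) : Prop :=
  ∀ k, (X.corr k).IsDiag ∧ ∀ l, ∑ i, X.sig k i l ^ 2 = (N : ℝ)

/-- The `l`-th stream (or signature sequence) of user `k` is active. -/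
def IsActive (X : CDMASystem N nbar) (k : Fin K) (l : Fin (nbar k)) : Prop :=
  0 < X.corr k l l

/-- The `l`-th signature sequence of user `k` is an active nonzero sequence that is orthogonal to
every other active signature sequence of the system, of whichever user. -/
def IsActiveOrthogonal (X : CDMASystem N nbar) (k : Fin K) (l : Fin (nbar k)) : Prop :=
  X.IsActive k l ∧ (X.sig k).col l ≠ 0 ∧
    ∀ (k' : Fin K) (l' : Fin (nbar k')), X.IsActive k' l' →
      (⟨k', l'⟩ : Σ j : Fin K, Fin (nbar j)) ≠ ⟨k, l⟩ →
      (X.sig k).col l ⬝ᵥ (X.sig k').col l' = 0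

/-- The number `n_k` of active signature sequences of user `k`. -/
noncomputable def numActive (X : CDMASystem N nbar) (k : Fin K) : ℕ :=
  {l | X.IsActive k l}.ncard

/-- The number `n_k^⊥` of active orthogonal signature sequences of user `k`. -/
noncomputable def numOrthogonal (X : CDMASystem N nbar) (k : Fin K) : ℕ :=
  {l | X.IsActiveOrthogonal k l}.ncard

end CDMASystem

/-- `n̂_k = (N - ∑_{k' < k} n̄_{k'}) p_k / ∑_{k' ≥ k} p_{k'}`; user `k` is oversized,
critically-sized or undersized according to `n̂_k > n̄_k`, `n̂_k = n̄_k` or `n̂_k < n̄_k`. -/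
noncomputable def nhat {K : ℕ} (N : ℕ) (nbar : Fin K → ℕ) (p : Fin K → ℝ) (k : Fin K) : ℝ :=
  ((N : ℝ) - ∑ k' ∈ Finset.Iio k, (nbar k' : ℝ)) * (p k / ∑ k' ∈ Finset.Ici k, p k')

/-- The number `K₂` of non-undersized users. -/
noncomputable def numNonUndersized {K : ℕ} (N : ℕ) (nbar : Fin K → ℕ) (p : Fin K → ℝ) : ℕ :=
  {k : Fin K | (nbar k : ℝ) ≤ nhat N nbar p k}.ncard

/-- `(N - ∑_{k' ≤ K₂} n̄_{k'}) p_k / ∑_{k' > K₂} p_{k'}`, with `1`-based indices `k'`. -/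
noncomputable def undersizedShare {K : ℕ} (N : ℕ) (nbar : Fin K → ℕ) (p : Fin K → ℝ)
    (k : Fin K) : ℝ :=
  ((N : ℝ) - ∑ k' : Fin K with k'.val < numNonUndersized N nbar p, (nbar k' : ℝ)) *
    (p k / ∑ k' : Fin K with numNonUndersized N nbar p ≤ k'.val, p k')

/-! The optimum is a water-filling. A non-undersized user spreads its energy `N * p k` evenly over
`nbar k` dimensions of its own, at level `lam k = N * p k / nbar k`. The undersized users share the
remaining `D` dimensions at a common level `lam₀`, which is lowest of all. The ratio `N * p k / lam
k` is then `nbar k` or `undersizedShare`, and the theorem is about its ceiling and floor.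

Optimality (`det_le`): for any feasible system, Gram–Schmidt on the signatures of the non-undersized
users, taken by decreasing level, gives an orthonormal basis in which user `k` has no energy at
positions of level below `lam k`. A weighted Hadamard inequality with weights `1 + level / σ ^ 2`
then bounds the determinant by the product of the weights. Equality forces the total covariance to
be diagonal with the levels as entries, and each user to live where the level equals `lam k`.

Counting: in the equality case the covariance of user `k` is at most `lam k` times the identity, so
its trace `N * p k` is at most `lam k` times its rank, hence at most `lam k * n_k`. An active
orthogonal sequence is an eigenvector of that covariance with eigenvalue `lam k`, so `lam k * n_k^⊥
≤ N * p k`. Integrality gives the ceiling and the floor.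

Attainment (`exists_waterFilling`): cut `N * p k / lam k` into unit pieces and one fractional piece,
and take a Parseval frame with these squared norms. Its unit columns are orthogonal to all the
others. -/

namespace Matrix

/-! ### Determinant, trace and rank inequalities; triangularization. -/

section Orthogonal

variable {n ι : Type*} [Fintype n] [DecidableEq n]

/-- A weighted form of Hadamard's determinant inequality, with its equality case. -/
theorem PosDef.det_le_prod_of_sum_div_le {X : Matrix n n ℝ} (hX : X.PosDef) {w : n → ℝ}
    (hw : ∀ i, 0 < w i) (h : ∑ i, X i i / w i ≤ Fintype.card n) :
    X.det ≤ ∏ i, w i ∧ (∏ i, w i ≤ X.det → X = diagonal w) := by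
  -- Rescaling by `w ^ (-1/2)` on both sides reduces to trace at most `n`, where `log x ≤ x - 1` on
  -- the eigenvalues gives `det ≤ 1`, with equality only if all eigenvalues are 1.
  set d : n → ℝ := fun i => 1 / √(w i) with hd
  have hd2 : ∀ i, d i * d i = 1 / w i := fun i => by
    simp only [hd]
    rw [div_mul_div_comm, Real.mul_self_sqrt (hw i).le, one_mul]
  have hd0 : ∀ i, d i ≠ 0 := fun i => by
    have := Real.sqrt_pos.2 (hw i)
    simp only [hd]; positivity
  set Y : Matrix n n ℝ := diagonal d * X * diagonal d with hYdef
  have hYe : ∀ i j, Y i j = d i * X i j * d j := fun i j => by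
    simp [hYdef, Matrix.mul_diagonal, Matrix.diagonal_mul]
  have hY : Y.PosDef := by
    have := hX.conjTranspose_mul_mul_same (B := diagonal d) (by
      apply Matrix.mulVec_injective_of_isUnit
      rw [Matrix.isUnit_iff_isUnit_det, det_diagonal]
      exact (Finset.prod_ne_zero_iff.2 fun i _ => hd0 i).isUnit)
    simpa [hYdef, diagonal_conjTranspose] using this
  have hdet : Y.det * ∏ i, w i = X.det := by
    rw [hYdef, det_mul, det_mul, det_diagonal]
    have : (∏ i, d i) * (∏ i, d i) * ∏ i, w i = 1 := by
      rw [← Finset.prod_mul_distrib, ← Finset.prod_mul_distrib]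
      exact Finset.prod_eq_one fun i _ => by rw [hd2, one_div_mul_cancel (hw i).ne']
    linear_combination X.det * this
  have htr : ∑ i, hY.1.eigenvalues i ≤ Fintype.card n := by
    have h1 := hY.1.trace_eq_sum_eigenvalues
    simp only [RCLike.ofReal_real_eq_id, id] at h1
    rw [← h1, trace]
    refine le_trans (le_of_eq (Finset.sum_congr rfl fun i _ => ?_)) h
    rw [diag_apply, hYe, mul_right_comm, hd2]; ring
  have hpos := hY.eigenvalues_pos
  have hlog : Real.log Y.det = ∑ i, Real.log (hY.1.eigenvalues i) := by
    rw [hY.1.det_eq_prod_eigenvalues]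
    simp only [RCLike.ofReal_real_eq_id, id]
    exact Real.log_prod fun i _ => (hpos i).ne'
  have hle : ∀ i, Real.log (hY.1.eigenvalues i) ≤ hY.1.eigenvalues i - 1 := fun i =>
    Real.log_le_sub_one_of_pos (hpos i)
  have hsum : ∑ i, (hY.1.eigenvalues i - 1) ≤ 0 := by
    rw [Finset.sum_sub_distrib]; simpa using htr
  have hW : 0 < ∏ i, w i := Finset.prod_pos fun i _ => hw i
  constructor
  · have : Y.det ≤ 1 := by
      rw [← Real.log_nonpos_iff hY.det_pos.le, hlog]
      exact (Finset.sum_le_sum fun i _ => hle i).trans hsum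
    rw [← hdet]
    exact mul_le_of_le_one_left hW.le this
  · intro hge
    have h1 : 1 ≤ Y.det := by
      rw [← hdet] at hge
      exact (le_mul_iff_one_le_left hW).1 hge
    have h0 : 0 ≤ Real.log Y.det := Real.log_nonneg h1
    have hz : ∑ i, (hY.1.eigenvalues i - 1 - Real.log (hY.1.eigenvalues i)) = 0 := by
      apply le_antisymm
      · rw [Finset.sum_sub_distrib, ← hlog]; linarith
      · exact Finset.sum_nonneg fun i _ => sub_nonneg.2 (hle i)
    have he : hY.1.eigenvalues = fun _ => 1 := by
      funext i
      by_contra hne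
      have := (Finset.sum_eq_zero_iff_of_nonneg
        (fun i _ => sub_nonneg.2 (hle i))).1 hz i (Finset.mem_univ i)
      have := Real.log_lt_sub_one_of_pos (hpos i) hne
      linarith
    have hY1 : Y = 1 := by
      rw [hY.1.spectral_theorem, he]
      have : diagonal ((RCLike.ofReal : ℝ → ℝ) ∘ fun _ : n => (1 : ℝ)) = 1 := by
        ext i j; simp [diagonal_apply, one_apply]
      rw [this, map_one]
    ext i j
    have := congrFun (congrFun hY1 i) j
    rw [hYe] at this
    by_cases hij : i = j
    · subst hij
      rw [one_apply_eq, mul_right_comm, hd2] at this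
      rw [diagonal_apply_eq]
      have := hw i
      field_simp at *
      linarith
    · rw [one_apply_ne hij] at this
      rw [diagonal_apply_ne _ hij]
      simpa [hd0 i, hd0 j] using this

theorem PosSemidef.trace_le_mul_rank {A : Matrix n n ℝ} (hA : A.PosSemidef) {c : ℝ}
    (hc : (c • (1 : Matrix n n ℝ) - A).PosSemidef) : A.trace ≤ c * A.rank := by
  have hle : ∀ i, hA.1.eigenvalues i ≤ c := fun i => by
    have h1 := hc.dotProduct_mulVec_nonneg (hA.1.eigenvectorBasis i)
    have h2 : star (hA.1.eigenvectorBasis i : n → ℝ) ⬝ᵥ (hA.1.eigenvectorBasis i : n → ℝ) = 1 := by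
      have := hA.1.eigenvectorBasis.orthonormal.1 i
      have h3 := real_inner_self_eq_norm_sq (hA.1.eigenvectorBasis i)
      rw [this, EuclideanSpace.inner_eq_star_dotProduct] at h3
      simpa [dotProduct_comm] using h3
    rw [sub_mulVec, hA.1.mulVec_eigenvectorBasis, dotProduct_sub, smul_mulVec, one_mulVec,
      dotProduct_smul, dotProduct_smul, h2] at h1
    simpa using h1
  have h1 := hA.1.trace_eq_sum_eigenvalues
  simp only [RCLike.ofReal_real_eq_id, id] at h1
  rw [h1, hA.1.rank_eq_card_non_zero_eigs, Fintype.card_subtype,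
    ← Finset.sum_filter_ne_zero, mul_comm, ← nsmul_eq_mul]
  exact Finset.sum_le_card_nsmul _ _ _ fun i _ => hle i

theorem PosSemidef.mul_card_le_trace [Fintype ι] [DecidableEq ι] {A : Matrix n n ℝ}
    (hA : A.PosSemidef) {c : ℝ} {U : Matrix n ι ℝ} (hU : Uᵀ * U = 1) (hAU : A * U = c • U) :
    c * Fintype.card ι ≤ A.trace := by
  -- The projection off the span of `U`: the compression `P * A * P` keeps a nonnegative trace once
  -- the eigenvectors in `U` are removed.
  set P : Matrix n n ℝ := 1 - U * Uᵀ with hP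
  have hPT : Pᵀ = P := by simp [hP]
  have hPP : P * P = P := by
    have : U * Uᵀ * (U * Uᵀ) = U * Uᵀ := by
      rw [Matrix.mul_assoc, ← Matrix.mul_assoc Uᵀ, hU, Matrix.one_mul]
    rw [hP, Matrix.mul_sub, Matrix.sub_mul, Matrix.sub_mul, this]
    simp
  have h := (hA.conjTranspose_mul_mul_same P).trace_nonneg
  rw [conjTranspose_eq_transpose_of_trivial, hPT, trace_mul_comm, ← Matrix.mul_assoc, hPP,
    trace_mul_comm, hP, Matrix.mul_sub, trace_sub, Matrix.mul_one, ← Matrix.mul_assoc, hAU,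
    smul_mul, trace_smul, trace_mul_comm U, hU, trace_one, smul_eq_mul] at h
  linarith

theorem PosSemidef.apply_eq_zero_of_diag {A : Matrix n n ℝ} (hA : A.PosSemidef) {i : n}
    (hi : A i i = 0) (j : n) : A i j = 0 ∧ A j i = 0 := by
  have h : A *ᵥ Pi.single i 1 = 0 := by
    rw [← hA.dotProduct_mulVec_zero_iff]
    simp [hi]
  have h1 : A j i = 0 := by simpa using congrFun h j
  refine ⟨?_, h1⟩
  rw [← hA.1.apply i j]; simpa using h1

/-- Gram–Schmidt: some orthogonal change of basis makes a finite sequence of vectors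
triangular. -/
theorem exists_orthogonal_triangular {N : ℕ} (f : Fin N → Fin N → ℝ) :
    ∃ Q : Matrix (Fin N) (Fin N) ℝ, Qᵀ * Q = 1 ∧ ∀ i j, i < j → (Qᵀ *ᵥ f i) j = 0 := by
  have hdim : Module.finrank ℝ (EuclideanSpace ℝ (Fin N)) = Fintype.card (Fin N) := by simp
  set g : Fin N → EuclideanSpace ℝ (Fin N) := fun i => WithLp.toLp 2 (f i) with hg
  set b := InnerProductSpace.gramSchmidtOrthonormalBasis hdim g with hb
  refine ⟨Matrix.of fun i j => b j i, ?_, fun i j hij => ?_⟩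
  · ext i j
    have h := orthonormal_iff_ite.1 b.orthonormal i j
    rw [EuclideanSpace.inner_eq_star_dotProduct] at h
    simp only [star_trivial] at h
    rw [mul_apply, one_apply, ← h]
    simp [dotProduct, mul_comm]
  · have h := InnerProductSpace.gramSchmidtOrthonormalBasis_inv_triangular hdim g hij
    rw [EuclideanSpace.inner_eq_star_dotProduct] at h
    rw [← h]
    simp [mulVec, dotProduct, hg, hb, mul_comm]

end Orthogonal

end Matrix

theorem exists_equiv_antitone {R : Type*} [Fintype R] {N : ℕ} (hR : Fintype.card R = N)
    (w : R → ℝ) : ∃ e : Fin N ≃ R, Antitone (w ∘ e) := by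
  let e := (Fintype.equivFinOfCardEq hR).symm
  refine ⟨(Tuple.sort fun i => -w (e i)).trans e, fun i j hij => ?_⟩
  have := Tuple.monotone_sort (fun i => -w (e i)) hij
  simpa using this

/-! ### Parseval frames with prescribed column norms. -/

namespace Matrix

variable {κ ι : Type*} [Fintype κ] [Fintype ι] [DecidableEq ι]

/-- A Givens rotation of the columns `a` and `b`. -/
theorem exists_rotate_columns (G : Matrix κ ι ℝ) {a b : ι} (hab : a ≠ b) {t : ℝ}
    (hb : ∑ i, G i b ^ 2 ≤ t) (ha : t ≤ ∑ i, G i a ^ 2) :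
    ∃ H : Matrix κ ι ℝ, H * Hᵀ = G * Gᵀ ∧ ∑ i, H i a ^ 2 = t ∧
      ∑ i, H i b ^ 2 = ∑ i, G i a ^ 2 + ∑ i, G i b ^ 2 - t ∧
      ∀ j, j ≠ a → j ≠ b → ∀ i, H i j = G i j := by
  -- The squared norm of the rotated column runs from that of column `a` at angle 0 to that of
  -- column `b` at a right angle.
  obtain ⟨θ, -, hθ⟩ : t ∈ (fun θ : ℝ => ∑ i, (Real.cos θ * G i a + Real.sin θ * G i b) ^ 2) ''
      Set.Icc 0 (Real.pi / 2) := by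
    apply intermediate_value_Icc' Real.pi_div_two_pos.le
    · fun_prop
    · simpa using ⟨hb, ha⟩
  simp only at hθ
  set c := Real.cos θ
  set s := Real.sin θ
  have hcs : c ^ 2 + s ^ 2 = 1 := Real.cos_sq_add_sin_sq θ
  let H : Matrix κ ι ℝ := Matrix.of fun i j =>
    if j = a then c * G i a + s * G i b else if j = b then -s * G i a + c * G i b else G i j
  have hHa : ∀ i, H i a = c * G i a + s * G i b := fun i => by simp [H]
  have hHb : ∀ i, H i b = -s * G i a + c * G i b := fun i => by simp [H, hab.symm]
  have hHj : ∀ j, j ≠ a → j ≠ b → ∀ i, H i j = G i j := fun j h1 h2 i => by simp [H, h1, h2]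
  refine ⟨H, ?_, ?_, ?_, hHj⟩
  · ext i k
    simp only [mul_apply, transpose_apply]
    rw [← Finset.sum_add_sum_compl {a, b}, ← Finset.sum_add_sum_compl {a, b},
      Finset.sum_pair hab, Finset.sum_pair hab]
    congr 1
    · rw [hHa, hHa, hHb, hHb]
      linear_combination (G i a * G k a + G i b * G k b) * hcs
    · refine Finset.sum_congr rfl fun j hj => ?_
      simp only [Finset.mem_compl, Finset.mem_insert, Finset.mem_singleton, not_or] at hj
      rw [hHj j hj.1 hj.2, hHj j hj.1 hj.2]
  · simpa only [hHa] using hθ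
  · rw [← hθ, ← Finset.sum_add_distrib, ← Finset.sum_sub_distrib]
    refine Finset.sum_congr rfl fun i _ => ?_
    rw [hHb]
    linear_combination (G i a ^ 2 + G i b ^ 2) * hcs

variable [DecidableEq κ]

/-- A Parseval frame of a space of dimension `card κ` with prescribed squared norms `f j ≤ 1`. -/
theorem exists_parseval_frame (f : ι → ℝ) (h0 : ∀ j, 0 ≤ f j) (h1 : ∀ j, f j ≤ 1)
    (hs : ∑ j, f j = Fintype.card κ) :
    ∃ G : Matrix κ ι ℝ, G * Gᵀ = 1 ∧ ∀ j, ∑ i, G i j ^ 2 = f j := by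
  classical
  induction hn : (Finset.univ.filter fun j => f j ≠ 0 ∧ f j ≠ 1).card using Nat.strong_induction_on
    generalizing f with
  | _ n ih =>
  by_cases hfrac : ∃ a, f a ≠ 0 ∧ f a ≠ 1
  · obtain ⟨a, ha0, ha1⟩ := hfrac
    -- A single fractional norm would put the integer total strictly between two consecutive
    -- integers.
    obtain ⟨b, hba, hb0, hb1⟩ : ∃ b, b ≠ a ∧ f b ≠ 0 ∧ f b ≠ 1 := by
      by_contra! hcon
      have hsum : ∑ j ∈ Finset.univ.erase a, f j =
          (((Finset.univ.erase a).filter fun j => f j ≠ 0).card : ℝ) := by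
        rw [Finset.card_filter, Nat.cast_sum]
        refine Finset.sum_congr rfl fun j hj => ?_
        by_cases hj0 : f j = 0
        · simp [hj0]
        · simp [hcon j (Finset.ne_of_mem_erase hj) hj0]
      rw [← Finset.add_sum_erase _ _ (Finset.mem_univ a), hsum] at hs
      have hp : 0 < f a := lt_of_le_of_ne (h0 a) (Ne.symm ha0)
      have hl : f a < 1 := lt_of_le_of_ne (h1 a) ha1
      set m := ((Finset.univ.erase a).filter fun j => f j ≠ 0).card
      have e1 : (m : ℝ) < Fintype.card κ := by linarith
      have e2 : (Fintype.card κ : ℝ) < m + 1 := by linarith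
      norm_cast at e1 e2
      omega
    set s := f a + f b with hsdef
    -- Mass moves from `b` to `a` until one of the two norms is 0 or 1, so fewer are fractional. A
    -- rotation of the frame obtained for `f'` restores `f`.
    set f' : ι → ℝ := fun j => if j = a then min 1 s else if j = b then s - min 1 s else f j
      with hf'
    have hf'a : f' a = min 1 s := by simp [hf']
    have hf'b : f' b = s - min 1 s := by simp [hf', hba]
    have hf'j : ∀ j, j ≠ a → j ≠ b → f' j = f j := fun j h1 h2 => by simp [hf', h1, h2]
    have hma : f a ≤ min 1 s := le_min (h1 a) (by linarith [h0 b])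
    have hmb : f b ≤ min 1 s := le_min (h1 b) (by linarith [h0 a])
    have hs0 : 0 ≤ s := add_nonneg (h0 a) (h0 b)
    have hs2 : s - min 1 s ≤ 1 := by linarith [h1 b]
    have hlt : (Finset.univ.filter fun j => f' j ≠ 0 ∧ f' j ≠ 1).card < n := by
      rw [← hn]
      apply Finset.card_lt_card
      rw [Finset.ssubset_iff_of_subset]
      · rcases le_total s 1 with h | h
        · exact ⟨b, by simp [hb0, hb1], by simp [hf'b, h]⟩
        · exact ⟨a, by simp [ha0, ha1], by simp [hf'a, h]⟩
      · intro j hj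
        by_cases hja : j = a
        · subst hja; simp [ha0, ha1]
        by_cases hjb : j = b
        · subst hjb; simp [hb0, hb1]
        · rw [Finset.mem_filter, hf'j j hja hjb] at hj
          simpa using hj
    have hsum' : ∑ j, f' j = Fintype.card κ := by
      rw [← hs, ← Finset.sum_add_sum_compl {a, b}, ← Finset.sum_add_sum_compl {a, b} f,
        Finset.sum_pair hba.symm, Finset.sum_pair hba.symm, hf'a, hf'b]
      congr 1
      · ring
      · refine Finset.sum_congr rfl fun j hj => ?_
        simp only [Finset.mem_compl, Finset.mem_insert, Finset.mem_singleton, not_or] at hj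
        exact hf'j j hj.1 hj.2
    obtain ⟨G, hG, hGn⟩ := ih _ hlt f' (fun j => by
      by_cases hja : j = a
      · subst hja; rw [hf'a]; exact le_min zero_le_one hs0
      by_cases hjb : j = b
      · subst hjb; rw [hf'b]; linarith [min_le_right 1 s]
      · rw [hf'j j hja hjb]; exact h0 j) (fun j => by
      by_cases hja : j = a
      · subst hja; rw [hf'a]; exact min_le_left _ _
      by_cases hjb : j = b
      · subst hjb; rwa [hf'b]
      · rw [hf'j j hja hjb]; exact h1 j) hsum' rfl
    obtain ⟨H, hH, hHa, hHb, hHj⟩ := exists_rotate_columns G hba.symm (t := f a)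
      (by rw [hGn, hf'b]; linarith) (by rw [hGn, hf'a]; exact hma)
    refine ⟨H, hH.trans hG, fun j => ?_⟩
    by_cases hja : j = a
    · subst hja; exact hHa
    by_cases hjb : j = b
    · subst hjb; rw [hHb, hGn, hGn, hf'a, hf'b]; ring
    · simp only [hHj j hja hjb, hGn, hf'j j hja hjb]
  · push Not at hfrac
    have hcard : Fintype.card {j // f j ≠ 0} = Fintype.card κ := by
      have : ∑ j, f j = ((Finset.univ.filter fun j => f j ≠ 0).card : ℝ) := by
        rw [Finset.card_filter, Nat.cast_sum]
        refine Finset.sum_congr rfl fun j _ => ?_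
        by_cases hj0 : f j = 0
        · simp [hj0]
        · simp [hfrac j hj0]
      rw [Fintype.card_subtype]
      rw [hs] at this
      exact_mod_cast this.symm
    let e := Fintype.equivOfCardEq hcard
    refine ⟨Matrix.of fun i j => if (e.symm i : ι) = j then 1 else 0, ?_, fun j => ?_⟩
    · ext i k
      simp [mul_apply, one_apply, Subtype.ext_iff.symm, eq_comm]
    · by_cases hj0 : f j = 0
      · rw [hj0]
        refine Finset.sum_eq_zero fun i _ => ?_
        have : (e.symm i : ι) ≠ j := fun h => (e.symm i).2 (h ▸ hj0)
        simp [this]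
      · have : ∀ i, (e.symm i : ι) = j ↔ i = e ⟨j, hj0⟩ := fun i => by
          rw [← Equiv.symm_apply_eq, Subtype.ext_iff]
        simp [this, hfrac j hj0]

/-- A column of unit norm of a Parseval frame is orthogonal to the other columns. -/
theorem sum_mul_eq_zero_of_parseval {G : Matrix κ ι ℝ} (hG : G * Gᵀ = 1) {j j' : ι}
    (hj : ∑ i, G i j ^ 2 = 1) (hne : j' ≠ j) : ∑ i, G i j * G i j' = 0 := by
  set P : Matrix ι ι ℝ := Gᵀ * G with hP
  have hPP : P * P = P := by
    rw [hP, Matrix.mul_assoc, ← Matrix.mul_assoc G, hG, Matrix.one_mul]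
  have hPe : ∀ a b, P a b = ∑ i, G i a * G i b := fun a b => by simp [hP, mul_apply]
  have hsymm : ∀ a b, P a b = P b a := fun a b => by simp [hPe, mul_comm]
  have hjj : P j j = 1 := by rw [hPe, ← hj]; simp [sq]
  have h := congrFun (congrFun hPP j) j
  -- For the projection `Gᵀ * G`, a diagonal entry 1 is the sum of the squares of its row, so the
  -- rest of the row vanishes.
  rw [mul_apply, ← Finset.add_sum_erase _ _ (Finset.mem_univ j), hjj, mul_one,
    add_eq_left] at h
  have := (Finset.sum_eq_zero_iff_of_nonneg (fun a _ => by
    rw [hsymm a j]; exact mul_self_nonneg _)).1 h j' (by simp [hne])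
  rw [hsymm j' j, mul_self_eq_zero, hPe] at this
  exact this

end Matrix

/-! ### Water-filling levels. -/

/-- The levels `lam k` of the water-filling solution: a user in `T` spreads its power evenly over
`nbar k` dimensions of its own, and the other users share the remaining `D` dimensions at the
common level `lam₀`. -/
structure IsLevelProfile {K : ℕ} (N D : ℕ) (nbar : Fin K → ℕ) (p : Fin K → ℝ)
    (T : Finset (Fin K)) (lam : Fin K → ℝ) (lam₀ : ℝ) : Prop where
  dim : ∑ k ∈ T, nbar k + D = N
  pos : ∀ k, 0 < lam k
  base_nonneg : 0 ≤ lam₀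
  base_le : ∀ k, lam₀ ≤ lam k
  eq_base : ∀ k, k ∉ T → lam k = lam₀
  energy_mem : ∀ k ∈ T, lam k * nbar k = N * p k
  energy_base : lam₀ * D = ∑ k ∈ Tᶜ, N * p k
  energy_le : ∀ k, N * p k ≤ lam k * nbar k

/-- One dimension for each stream of a user in `T`, and `D` more. -/
abbrev DimIndex {K : ℕ} (D : ℕ) (nbar : Fin K → ℕ) (T : Finset (Fin K)) : Type :=
  {j : Σ k : Fin K, Fin (nbar k) // j.1 ∈ T} ⊕ Fin D

/-- The level of a dimension. -/
def dimLevel {K D : ℕ} {nbar : Fin K → ℕ} {T : Finset (Fin K)} (lam : Fin K → ℝ) (lam₀ : ℝ) :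
    DimIndex D nbar T → ℝ :=
  Sum.elim (fun j => lam j.1.1) fun _ => lam₀

theorem sum_dimLevel {K D : ℕ} {nbar : Fin K → ℕ} {T : Finset (Fin K)} (lam : Fin K → ℝ)
    (lam₀ : ℝ) (g : ℝ → ℝ) :
    ∑ r : DimIndex D nbar T, g (dimLevel lam lam₀ r) =
      ∑ k ∈ T, (nbar k : ℝ) * g (lam k) + D * g lam₀ := by
  rw [Fintype.sum_sum_type]
  congr 1
  · have : ∑ j : {j : Σ k : Fin K, Fin (nbar k) // j.1 ∈ T}, g (lam j.1.1) =
        ∑ j : Σ k : Fin K, Fin (nbar k), if j.1 ∈ T then g (lam j.1) else 0 := by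
      rw [← Finset.sum_filter]
      exact (Finset.sum_subtype (Finset.univ.filter fun j : Σ k : Fin K, Fin (nbar k) => j.1 ∈ T)
        (by simp) fun j => g (lam j.1)).symm
    simp only [dimLevel, Sum.elim_inl]
    rw [this, Fintype.sum_sigma]
    simp
  · simp [dimLevel]

theorem dimLevel_nonneg {K N D : ℕ} {nbar : Fin K → ℕ} {p : Fin K → ℝ} {T : Finset (Fin K)}
    {lam : Fin K → ℝ} {lam₀ : ℝ} (hL : IsLevelProfile N D nbar p T lam lam₀)
    (r : DimIndex D nbar T) : 0 ≤ dimLevel lam lam₀ r := by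
  rcases r with j | d
  · exact (hL.pos _).le
  · exact hL.base_nonneg

theorem dimLevel_ge {K N D : ℕ} {nbar : Fin K → ℕ} {p : Fin K → ℝ} {T : Finset (Fin K)}
    {lam : Fin K → ℝ} {lam₀ : ℝ} (hL : IsLevelProfile N D nbar p T lam lam₀)
    (r : DimIndex D nbar T) : lam₀ ≤ dimLevel lam lam₀ r := by
  rcases r with j | d
  · exact hL.base_le _
  · exact le_rfl

theorem IsLevelProfile.card_dimIndex {K N D : ℕ} {nbar : Fin K → ℕ} {p : Fin K → ℝ}
    {T : Finset (Fin K)} {lam : Fin K → ℝ} {lam₀ : ℝ}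
    (hL : IsLevelProfile N D nbar p T lam lam₀) : Fintype.card (DimIndex D nbar T) = N := by
  have h := sum_dimLevel (D := D) (nbar := nbar) (T := T) lam lam₀ fun _ => 1
  simp only [Finset.sum_const, Finset.card_univ, nsmul_eq_mul, mul_one] at h
  rw [← hL.dim]
  exact_mod_cast h

/-- This is the trace budget of the weighted Hadamard inequality, met exactly: a dimension of level
`x` contributes `1 / (1 + x / q)` from the noise and `(x / q) / (1 + x / q)` from the signals, which
add up to 1. -/
theorem IsLevelProfile.weight_sum {K N D : ℕ} {nbar : Fin K → ℕ} {p : Fin K → ℝ}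
    {T : Finset (Fin K)} {lam : Fin K → ℝ} {lam₀ : ℝ}
    (hL : IsLevelProfile N D nbar p T lam lam₀) {q : ℝ} (hq : 0 < q) :
    ∑ r : DimIndex D nbar T, 1 / (1 + dimLevel lam lam₀ r / q) +
      ∑ k, N * p k / q / (1 + lam k / q) = N := by
  rw [sum_dimLevel lam lam₀ fun x => 1 / (1 + x / q), ← Finset.sum_add_sum_compl T]
  have hc : ∑ k ∈ Tᶜ, N * p k / q / (1 + lam k / q) = lam₀ * D / q / (1 + lam₀ / q) := by
    rw [hL.energy_base, Finset.sum_div, Finset.sum_div]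
    exact Finset.sum_congr rfl fun k hk => by rw [hL.eq_base k (Finset.mem_compl.1 hk)]
  have ht : ∑ k ∈ T, (nbar k : ℝ) * (1 / (1 + lam k / q)) +
      ∑ k ∈ T, N * p k / q / (1 + lam k / q) = ∑ k ∈ T, (nbar k : ℝ) := by
    rw [← Finset.sum_add_distrib]
    refine Finset.sum_congr rfl fun k hk => ?_
    have := hL.pos k
    rw [← hL.energy_mem k hk]
    field_simp
  have hd : (D : ℝ) * (1 / (1 + lam₀ / q)) + lam₀ * D / q / (1 + lam₀ / q) = D := by
    have := hL.base_nonneg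
    have : q + lam₀ ≠ 0 := by positivity
    field_simp
  have hN : ∑ k ∈ T, (nbar k : ℝ) + D = N := by
    rw [← hL.dim]; push_cast; rfl
  rw [hc]
  linarith

/-! ### The determinant bound and the structure of optimal systems. -/

namespace CDMASystem

open scoped Matrix

variable {K N : ℕ} {nbar : Fin K → ℕ}

/-- The correlation matrix `S_k P_k S_kᵀ` of the signal of user `k`. -/
def userCov (X : CDMASystem N nbar) (k : Fin K) : Matrix (Fin N) (Fin N) ℝ :=
  X.sig k * X.corr k * (X.sig k).transpose

theorem sigMatrix_mul_corrMatrix_mul (X : CDMASystem N nbar) :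
    X.sigMatrix * X.corrMatrix * X.sigMatrix.transpose = ∑ k, X.userCov k := by
  ext i j
  rw [Matrix.sum_apply, Matrix.mul_apply, Fintype.sum_sigma]
  refine Finset.sum_congr rfl fun k _ => ?_
  rw [userCov, Matrix.mul_apply]
  refine Finset.sum_congr rfl fun l _ => ?_
  rw [Matrix.mul_apply, Matrix.mul_apply, Fintype.sum_sigma, Finset.sum_eq_single k]
  · simp [sigMatrix, corrMatrix, Matrix.blockDiagonal'_apply_eq]
  · intro k' _ hk'
    refine Finset.sum_eq_zero fun l' _ => ?_
    rw [corrMatrix, Matrix.blockDiagonal'_apply_ne _ _ _ hk', mul_zero]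
  · simp

variable {p : Fin K → ℝ} {X : CDMASystem N nbar}

theorem IsFeasible.userCov_posSemidef (hX : X.IsFeasible p) (k : Fin K) :
    (X.userCov k).PosSemidef := by
  have := (hX k).1.mul_mul_conjTranspose_same (X.sig k)
  rwa [Matrix.conjTranspose_eq_transpose_of_trivial] at this

theorem IsFeasible.trace_userCov (hN : 0 < N) (hX : X.IsFeasible p) (k : Fin K) :
    (X.userCov k).trace = N * p k := by
  rw [← (hX k).2, userCov]
  have : (N : ℝ) ≠ 0 := by positivity
  field_simp

theorem IsFeasible.corr_mulVec_eq_zero (hX : X.IsFeasible p) (k : Fin K)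
    {y : Fin (nbar k) → ℝ} (hy : ∀ l, X.IsActive k l → y l = 0) : X.corr k *ᵥ y = 0 := by
  funext l
  rw [Matrix.mulVec, dotProduct, Pi.zero_apply]
  refine Finset.sum_eq_zero fun l' _ => ?_
  by_cases h : X.IsActive k l'
  · simp [hy l' h]
  · have h0 : X.corr k l' l' = 0 := le_antisymm (not_lt.1 h) (hX k).1.diag_nonneg
    simp [((hX k).1.apply_eq_zero_of_diag h0 l).2]

theorem IsFeasible.rank_userCov_le (hX : X.IsFeasible p) (k : Fin K) :
    (X.userCov k).rank ≤ X.numActive k := by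
  classical
  set E : Matrix (Fin (nbar k)) (Fin (nbar k)) ℝ :=
    Matrix.diagonal fun l => if X.IsActive k l then 1 else 0 with hE
  have hEP : E * X.corr k = X.corr k := by
    ext l l'
    rw [hE, Matrix.diagonal_mul]
    by_cases h : X.IsActive k l
    · simp [h]
    · have h0 : X.corr k l l = 0 := le_antisymm (not_lt.1 h) (hX k).1.diag_nonneg
      simp [((hX k).1.apply_eq_zero_of_diag h0 l').1]
  calc (X.userCov k).rank ≤ (X.corr k).rank :=
        (Matrix.rank_mul_le_left _ _).trans (Matrix.rank_mul_le_right _ _)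
    _ ≤ E.rank := by rw [← hEP]; exact Matrix.rank_mul_le_left _ _
    _ = X.numActive k := by
        rw [hE, Matrix.rank_diagonal, numActive, Set.ncard_eq_toFinset_card', Set.toFinset_card]
        exact Fintype.card_congr (Equiv.subtypeEquivRight fun l => by simp)

variable {D : ℕ} {T : Finset (Fin K)} {lam : Fin K → ℝ} {lam₀ : ℝ}

/-- Gram–Schmidt in order of decreasing level: if position `i` has level below `lam k`, every
signature of a user `k` in `T` precedes `i`, so its `i`-th coordinate is zero. The `D` shared
positions are filled with zero vectors. Users outside `T` are at the lowest level, so nothing is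
required of them. -/
theorem exists_rotation (X : CDMASystem N nbar) (hL : IsLevelProfile N D nbar p T lam lam₀)
    (e : Fin N ≃ DimIndex D nbar T) (he : Antitone (dimLevel lam lam₀ ∘ e)) :
    ∃ Q : Matrix (Fin N) (Fin N) ℝ, Q.transpose * Q = 1 ∧
      ∀ k i, (Q.transpose * X.userCov k * Q) i i ≠ 0 → lam k ≤ dimLevel lam lam₀ (e i) := by
  obtain ⟨Q, hQ, hQt⟩ := Matrix.exists_orthogonal_triangular fun i =>
    Sum.elim (fun j : {j : Σ k : Fin K, Fin (nbar k) // j.1 ∈ T} =>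
      (X.sig j.1.1).col j.1.2) (fun _ => 0) (e i)
  refine ⟨Q, hQ, fun k i => ?_⟩
  by_cases hk : k ∈ T
  · contrapose!
    intro hlt
    have hz : ∀ l, (Q.transpose * X.sig k) i l = 0 := fun l => by
      have hi : e.symm (Sum.inl ⟨⟨k, l⟩, hk⟩) < i := by
        by_contra! hle
        have := he hle
        simp only [Function.comp, Equiv.apply_symm_apply] at this
        exact absurd hlt (not_lt.2 this)
      have := hQt _ _ hi
      simpa [Matrix.mul_apply, Matrix.mulVec, dotProduct] using this
    have : Q.transpose * X.userCov k * Q =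
        (Q.transpose * X.sig k) * (X.corr k * ((X.sig k).transpose * Q)) := by
      simp only [userCov, Matrix.mul_assoc]
    rw [this, Matrix.mul_apply]
    exact Finset.sum_eq_zero fun l _ => by rw [hz, zero_mul]
  · intro _
    rw [hL.eq_base k hk]
    exact dimLevel_ge hL _

/-- The form of an optimal system in a suitable orthonormal basis `Q`. -/
def IsWaterFilled (X : CDMASystem N nbar) (lam : Fin K → ℝ) (μ : Fin N → ℝ)
    (Q : Matrix (Fin N) (Fin N) ℝ) : Prop :=
  Q.transpose * Q = 1 ∧ Q.transpose * (∑ k, X.userCov k) * Q = Matrix.diagonal μ ∧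
    ∀ k i, (Q.transpose * X.userCov k * Q) i i ≠ 0 → μ i = lam k

theorem IsFeasible.one_add_posDef (hX : X.IsFeasible p) {σ : ℝ} (hσ : 0 < σ) :
    (1 + (1 / σ ^ 2) • ∑ k, X.userCov k).PosDef :=
  Matrix.PosDef.one.add_posSemidef
    ((Matrix.posSemidef_sum _ fun k _ => hX.userCov_posSemidef k).smul (by positivity))

theorem IsFeasible.det_le (hN : 0 < N) (hL : IsLevelProfile N D nbar p T lam lam₀)
    (hX : X.IsFeasible p) {σ : ℝ} (hσ : 0 < σ)
    (e : Fin N ≃ DimIndex D nbar T) (he : Antitone (dimLevel lam lam₀ ∘ e)) :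
    (1 + (1 / σ ^ 2) • ∑ k, X.userCov k).det ≤ ∏ i, (1 + dimLevel lam lam₀ (e i) / σ ^ 2) ∧
      (∏ i, (1 + dimLevel lam lam₀ (e i) / σ ^ 2) ≤ (1 + (1 / σ ^ 2) • ∑ k, X.userCov k).det →
        ∃ Q, X.IsWaterFilled lam (fun i => dimLevel lam lam₀ (e i)) Q) := by
  obtain ⟨Q, hQ, hQd⟩ := X.exists_rotation hL e he
  have hQ' : Q * Q.transpose = 1 := mul_eq_one_comm.1 hQ
  set q := σ ^ 2 with hq
  have hq0 : 0 < q := by positivity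
  set B : Fin K → Matrix (Fin N) (Fin N) ℝ := fun k => Q.transpose * X.userCov k * Q with hB
  have hBpos : ∀ k, (B k).PosSemidef := fun k => by
    have := (hX.userCov_posSemidef k).conjTranspose_mul_mul_same Q
    rwa [Matrix.conjTranspose_eq_transpose_of_trivial] at this
  have hBtr : ∀ k, ∑ i, B k i i = N * p k := fun k => by
    have : (B k).trace = N * p k := by
      rw [hB, Matrix.trace_mul_cycle, hQ', Matrix.one_mul,
        hX.trace_userCov hN]
    exact this
  set Z := 1 + (1 / q) • ∑ k, X.userCov k with hZ
  have hZrot : Q.transpose * Z * Q = 1 + (1 / q) • ∑ k, B k := by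
    rw [hZ, Matrix.mul_add, Matrix.add_mul, Matrix.mul_one, hQ, Matrix.mul_smul, Matrix.smul_mul,
      Matrix.mul_sum, Matrix.sum_mul]
  have hdet : (Q.transpose * Z * Q).det = Z.det := by
    rw [Matrix.det_mul_comm, ← Matrix.mul_assoc, hQ', Matrix.one_mul]
  have hpd : (Q.transpose * Z * Q).PosDef := by
    rw [hZrot]
    exact Matrix.PosDef.one.add_posSemidef
      ((Matrix.posSemidef_sum _ fun k _ => hBpos k).smul (by positivity))
  set μ : Fin N → ℝ := fun i => dimLevel lam lam₀ (e i) with hμ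
  have hμ0 : ∀ i, 0 ≤ μ i := fun i => dimLevel_nonneg hL _
  have hw : ∀ i, 0 < 1 + μ i / q := fun i => by have := hμ0 i; positivity
  have hW : ∀ k, 0 < 1 + lam k / q := fun k => by have := hL.pos k; positivity
  -- Where user `k` has energy the level is at least `lam k`, so replacing `μ i` by `lam k` can only
  -- increase the term, strictly unless the two agree.
  have hterm : ∀ k i, B k i i / q / (1 + μ i / q) ≤ B k i i / q / (1 + lam k / q) ∧
      (B k i i / q / (1 + μ i / q) = B k i i / q / (1 + lam k / q) → B k i i ≠ 0 →
        μ i = lam k) := fun k i => by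
    have h0 : 0 ≤ B k i i := (hBpos k).diag_nonneg
    constructor
    · rcases h0.eq_or_lt with h | h
      · rw [← h]; simp
      · have := hQd k i h.ne'
        have h1 := hW k
        have h2 := hw i
        gcongr
    · intro heq hne
      have h1 : B k i i / q ≠ 0 := div_ne_zero hne hq0.ne'
      rw [div_eq_div_iff (hw i).ne' (hW k).ne'] at heq
      have := mul_left_cancel₀ h1 heq
      field_simp at this
      linarith
  have hweight : ∑ i, 1 / (1 + μ i / q) + ∑ k, ∑ i, B k i i / q / (1 + lam k / q) = N := by
    rw [← hL.weight_sum hq0, ← e.sum_comp]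
    congr 1
    refine Finset.sum_congr rfl fun k _ => ?_
    rw [← hBtr k, Finset.sum_div, Finset.sum_div]
  have hdiag : ∑ i, (Q.transpose * Z * Q) i i / (1 + μ i / q) =
      ∑ i, 1 / (1 + μ i / q) + ∑ k, ∑ i, B k i i / q / (1 + μ i / q) := by
    rw [Finset.sum_comm, ← Finset.sum_add_distrib, hZrot]
    refine Finset.sum_congr rfl fun i _ => ?_
    rw [Matrix.add_apply, Matrix.smul_apply, Matrix.sum_apply, Matrix.one_apply_eq, add_div,
      smul_eq_mul, Finset.mul_sum, Finset.sum_div]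
    congr 1
    exact Finset.sum_congr rfl fun k _ => by ring
  have hsum : ∑ i, (Q.transpose * Z * Q) i i / (1 + μ i / q) ≤ Fintype.card (Fin N) := by
    rw [hdiag, Fintype.card_fin, ← hweight]
    exact add_le_add_right (Finset.sum_le_sum fun k _ => Finset.sum_le_sum fun i _ =>
      (hterm k i).1) _
  obtain ⟨hle, heq⟩ := hpd.det_le_prod_of_sum_div_le hw hsum
  rw [hdet] at hle heq
  refine ⟨hle, fun hge => ⟨Q, hQ, ?_, fun k i => ?_⟩⟩
  · have h := heq hge
    rw [hZrot] at h
    rw [Matrix.mul_sum, Matrix.sum_mul]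
    have h2 : (1 / q) • ∑ k, B k = (1 / q) • Matrix.diagonal μ := by
      rw [← add_right_inj, h]
      ext i j
      by_cases hij : i = j
      · subst hij; simp; ring
      · simp [hij]
    exact smul_right_injective _ (one_div_ne_zero hq0.ne') h2
  · have h := heq hge
    have hN' : ∑ i, (Q.transpose * Z * Q) i i / (1 + μ i / q) = N := by
      rw [h]
      simp only [Matrix.diagonal_apply_eq]
      rw [Finset.sum_congr rfl fun i _ => div_self (hw i).ne']
      simp
    rw [hdiag, ← hweight, add_right_inj] at hN'
    have h1 := (Finset.sum_eq_sum_iff_of_le fun k _ =>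
      Finset.sum_le_sum fun i _ => (hterm k i).1).1 hN' k (Finset.mem_univ k)
    have h2 := (Finset.sum_eq_sum_iff_of_le fun i _ => (hterm k i).1).1 h1 i (Finset.mem_univ i)
    exact (hterm k i).2 h2

variable {μ : Fin N → ℝ} {Q : Matrix (Fin N) (Fin N) ℝ}

theorem IsWaterFilled.energy_le (hN : 0 < N) (hX : X.IsFeasible p) (hlam : ∀ k, 0 < lam k)
    (h : X.IsWaterFilled lam μ Q) (k : Fin K) : N * p k ≤ lam k * X.numActive k := by
  obtain ⟨hQ, hM, hs⟩ := h
  have hQ' : Q * Q.transpose = 1 := mul_eq_one_comm.1 hQ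
  set B : Fin K → Matrix (Fin N) (Fin N) ℝ := fun k => Q.transpose * X.userCov k * Q with hB
  have hBpos : ∀ k, (B k).PosSemidef := fun k => by
    have := (hX.userCov_posSemidef k).conjTranspose_mul_mul_same Q
    rwa [Matrix.conjTranspose_eq_transpose_of_trivial] at this
  have hBtr : (B k).trace = N * p k := by
    rw [hB, Matrix.trace_mul_cycle, hQ', Matrix.one_mul, hX.trace_userCov hN]
  have hrank : (B k).rank ≤ X.numActive k :=
    ((Matrix.rank_mul_le_left _ _).trans (Matrix.rank_mul_le_right _ _)).trans
      (hX.rank_userCov_le k)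
  have hrest : (Matrix.diagonal μ - B k).PosSemidef := by
    rw [← hM, Matrix.mul_sum, Matrix.sum_mul, ← Finset.sum_erase_eq_sub (Finset.mem_univ k)]
    exact Matrix.posSemidef_sum _ fun k' _ => hBpos k'
  -- With `F` the projection onto the positions of level `lam k`, which contain user `k`, `lam k • 1
  -- - B k` is the compression by `F` of the other users' covariance plus `lam k • (1 - F)`.
  set F : Matrix (Fin N) (Fin N) ℝ := Matrix.diagonal fun i => if μ i = lam k then 1 else 0 with hF
  have hFB : F * B k * F = B k := by
    ext i j
    rw [hF, Matrix.mul_diagonal, Matrix.diagonal_mul]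
    by_cases hi : B k i i = 0
    · simp [((hBpos k).apply_eq_zero_of_diag hi j).1]
    by_cases hj : B k j j = 0
    · simp [((hBpos k).apply_eq_zero_of_diag hj i).2]
    simp [hs k i hi, hs k j hj]
  have hle : (lam k • (1 : Matrix (Fin N) (Fin N) ℝ) - B k).PosSemidef := by
    have h1 := hrest.conjTranspose_mul_mul_same F
    have h2 : (Matrix.diagonal fun i => if μ i = lam k then 0 else lam k).PosSemidef :=
      Matrix.PosSemidef.diagonal fun i => by
        simp only [Pi.zero_apply]; split_ifs
        · exact le_rfl
        · exact (hlam k).le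
    convert h1.add h2 using 1
    rw [Matrix.conjTranspose_eq_transpose_of_trivial, hF, Matrix.diagonal_transpose, ← hF,
      Matrix.mul_sub, Matrix.sub_mul, hFB, hF, Matrix.diagonal_mul_diagonal,
      Matrix.diagonal_mul_diagonal, sub_add_eq_add_sub, Matrix.diagonal_add]
    congr 1
    ext i j
    by_cases hij : i = j
    · subst hij
      by_cases hi : μ i = lam k <;> simp [hi]
    · simp [hij]
  rw [← hBtr]
  refine ((hBpos k).trace_le_mul_rank hle).trans ?_
  have := hlam k
  gcongr

theorem IsWaterFilled.le_energy (hN : 0 < N) (hX : X.IsFeasible p) (hμ : ∀ i, 0 < μ i)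
    (h : X.IsWaterFilled lam μ Q) (k : Fin K) : lam k * X.numOrthogonal k ≤ N * p k := by
  classical
  obtain ⟨hQ, hM, hs⟩ := h
  have hQ' : Q * Q.transpose = 1 := mul_eq_one_comm.1 hQ
  set B : Matrix (Fin N) (Fin N) ℝ := Q.transpose * X.userCov k * Q with hB
  have hBpos : B.PosSemidef := by
    have := (hX.userCov_posSemidef k).conjTranspose_mul_mul_same Q
    rwa [Matrix.conjTranspose_eq_transpose_of_trivial] at this
  have hBtr : B.trace = N * p k := by
    rw [hB, Matrix.trace_mul_cycle, hQ', Matrix.one_mul, hX.trace_userCov hN]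
  have heig : ∀ l, X.IsActiveOrthogonal k l →
      B *ᵥ (Q.transpose *ᵥ (X.sig k).col l) = lam k • (Q.transpose *ᵥ (X.sig k).col l) := by
    intro l hl
    set s := (X.sig k).col l with hsdef
    set t := Q.transpose *ᵥ s with ht
    have hQt : Q *ᵥ t = s := by rw [ht, Matrix.mulVec_mulVec, hQ', Matrix.one_mulVec]
    -- Other users' active sequences are orthogonal to `s`, so the total covariance acts on `s` as
    -- that of user `k` alone.
    have hMs : (∑ k, X.userCov k) *ᵥ s = X.userCov k *ᵥ s := by
      rw [Matrix.sum_mulVec, Finset.sum_eq_single k _ (by simp)]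
      intro k' _ hk'
      rw [userCov, ← Matrix.mulVec_mulVec, ← Matrix.mulVec_mulVec, hX.corr_mulVec_eq_zero k',
        Matrix.mulVec_zero]
      intro l' hl'
      have := hl.2.2 k' l' hl' (fun h => hk' (congrArg Sigma.fst h))
      rw [dotProduct_comm] at this
      exact this
    have hBt : B *ᵥ t = Matrix.diagonal μ *ᵥ t := by
      rw [← hM, hB, ← Matrix.mulVec_mulVec, ← Matrix.mulVec_mulVec, ← Matrix.mulVec_mulVec,
        ← Matrix.mulVec_mulVec, hQt, hMs]
    funext i
    have hi := congrFun hBt i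
    rw [Matrix.mulVec_diagonal] at hi
    -- Outside the support of `B` the equation reads `0 = μ i * t i`, and positivity of `μ` forces
    -- `t i = 0`; on the support `μ i = lam k`.
    by_cases h0 : B i i = 0
    · have hz : (B *ᵥ t) i = 0 := by
        rw [Matrix.mulVec, dotProduct]
        exact Finset.sum_eq_zero fun j _ => by rw [(hBpos.apply_eq_zero_of_diag h0 j).1, zero_mul]
      have : t i = 0 := by
        rw [hz] at hi
        exact (mul_eq_zero.1 hi.symm).resolve_left (hμ i).ne'
      rw [hz, Pi.smul_apply, this, smul_zero]
    · rw [hi, hs k i h0, Pi.smul_apply, smul_eq_mul]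
  let ι := {l // X.IsActiveOrthogonal k l}
  let c : ι → ℝ := fun l => √((X.sig k).col l ⬝ᵥ (X.sig k).col l)
  have hcpos : ∀ l : ι, 0 < (X.sig k).col l ⬝ᵥ (X.sig k).col l := fun l => by
    have h0 : (X.sig k).col l ≠ 0 := l.2.2.1
    have := Matrix.dotProduct_star_self_pos_iff.2 h0
    simpa using this
  let U : Matrix (Fin N) ι ℝ :=
    Matrix.of fun i l => (1 / c l) * (Q.transpose *ᵥ (X.sig k).col l) i
  have hUcol : ∀ l : ι, U.col l = (1 / c l) • (Q.transpose *ᵥ (X.sig k).col l) := fun l => rfl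
  have hU : U.transpose * U = 1 := by
    ext l l'
    have h1 : (U.transpose * U) l l' = U.col l ⬝ᵥ U.col l' := rfl
    rw [h1, hUcol, hUcol, smul_dotProduct, dotProduct_smul, Matrix.mulVec_transpose,
      ← Matrix.dotProduct_mulVec, Matrix.mulVec_mulVec, hQ',
      Matrix.one_mulVec]
    by_cases hll : l = l'
    · subst hll
      rw [Matrix.one_apply_eq, smul_eq_mul, smul_eq_mul, ← mul_assoc, div_mul_div_comm,
        Real.mul_self_sqrt (hcpos l).le, one_mul, one_div_mul_cancel (hcpos l).ne']
    · rw [Matrix.one_apply_ne hll, l.2.2.2 k l' l'.2.1, smul_zero, smul_zero]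
      intro h
      apply hll
      exact Subtype.ext (sigma_mk_injective h).symm
  have hBU : B * U = lam k • U := by
    ext i l
    have h1 : (B * U) i l = (B *ᵥ U.col l) i := rfl
    have h2 : (lam k • U) i l = (lam k • U.col l) i := rfl
    rw [h1, h2, hUcol, Matrix.mulVec_smul, heig l l.2, smul_comm]
  have := hBpos.mul_card_le_trace hU hBU
  rw [hBtr] at this
  rwa [numOrthogonal, Set.ncard_eq_toFinset_card', Set.toFinset_card]

end CDMASystem

/-! ### Construction of an optimal system. -/

/-- The part of a total amount `x` that lies in the unit interval `[l, l + 1]`. -/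
def unitPart (x : ℝ) (l : ℕ) : ℝ := max 0 (min 1 (x - l))

theorem unitPart_nonneg (x : ℝ) (l : ℕ) : 0 ≤ unitPart x l := le_max_left _ _

theorem unitPart_le_one (x : ℝ) (l : ℕ) : unitPart x l ≤ 1 :=
  max_le zero_le_one (min_le_left _ _)

theorem unitPart_pos_iff {x : ℝ} {l : ℕ} : 0 < unitPart x l ↔ l < ⌈x⌉₊ := by
  rw [Nat.lt_ceil, unitPart, lt_max_iff, lt_min_iff]
  simp

theorem unitPart_eq_one {x : ℝ} {l : ℕ} (h : l < ⌊x⌋₊) : unitPart x l = 1 := by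
  have h1 : ((l + 1 : ℕ) : ℝ) ≤ x := (Nat.le_floor_iff' l.succ_ne_zero).1 h
  push_cast at h1
  rw [unitPart, min_eq_left (by linarith), max_eq_right zero_le_one]

theorem sum_unitPart {x : ℝ} (hx : 0 ≤ x) {n : ℕ} (hn : x ≤ n) :
    ∑ l : Fin n, unitPart x l = x := by
  have key : ∀ m : ℕ, ∑ l ∈ Finset.range m, unitPart x l = min x m := by
    intro m
    induction m with
    | zero => simp [hx]
    | succ m ih =>
      rw [Finset.sum_range_succ, ih, unitPart]
      push_cast
      rcases le_total x m with h | h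
      · rw [min_eq_left h, min_eq_left (by linarith : x ≤ m + 1), max_eq_left, add_zero]
        exact (min_le_right _ _).trans (by linarith)
      · rcases le_total x (m + 1) with h' | h'
        · rw [min_eq_right h, min_eq_left h', min_eq_right (by linarith),
            max_eq_right (by linarith)]
          ring
        · rw [min_eq_right h, min_eq_right h', min_eq_left (by linarith),
            max_eq_right zero_le_one]
  rw [Fin.sum_univ_eq_sum_range fun l => unitPart x l, key, min_eq_left hn]

section Frame

variable {K N D : ℕ} {nbar : Fin K → ℕ} {p : Fin K → ℝ} {T : Finset (Fin K)} {lam : Fin K → ℝ}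
  {lam₀ : ℝ}

/-- The squared norm of a stream in the frame of an optimal system. -/
noncomputable def streamShare (N : ℕ) (nbar : Fin K → ℕ) (p lam : Fin K → ℝ)
    (j : Σ k : Fin K, Fin (nbar k)) : ℝ :=
  unitPart (N * p j.1 / lam j.1) j.2

theorem IsLevelProfile.share_eq (hL : IsLevelProfile N D nbar p T lam lam₀) {k : Fin K}
    (hk : k ∈ T) : N * p k / lam k = nbar k := by
  rw [← hL.energy_mem k hk, mul_div_cancel_left₀ _ (hL.pos k).ne']

theorem IsLevelProfile.share_le (hL : IsLevelProfile N D nbar p T lam lam₀) (k : Fin K) :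
    N * p k / lam k ≤ nbar k := by
  rw [div_le_iff₀ (hL.pos k), mul_comm (nbar k : ℝ)]
  exact hL.energy_le k

theorem IsLevelProfile.share_nonneg (hL : IsLevelProfile N D nbar p T lam lam₀)
    (hp : ∀ k, 0 < p k) (k : Fin K) : 0 ≤ N * p k / lam k := by
  have := hp k
  have := hL.pos k
  positivity

theorem IsLevelProfile.streamShare_eq_one (hL : IsLevelProfile N D nbar p T lam lam₀)
    {j : Σ k : Fin K, Fin (nbar k)} (hj : j.1 ∈ T) : streamShare N nbar p lam j = 1 := by
  apply unitPart_eq_one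
  rw [hL.share_eq hj, Nat.floor_natCast]
  exact j.2.2

/-- The frame for the shared dimensions. The factor `lam₀` in the first conclusion covers the case
`lam₀ = 0`: all users are then in `T`, the `D` dimensions stay empty, and `G = 0` serves. -/
theorem IsLevelProfile.exists_base_frame (hL : IsLevelProfile N D nbar p T lam lam₀)
    (hp : ∀ k, 0 < p k) :
    ∃ G : Matrix (Fin D) (Σ k : Fin K, Fin (nbar k)) ℝ,
      (∀ d d', lam₀ * ∑ j, G d j * G d' j = if d = d' then lam₀ else 0) ∧
      (∀ j, ∑ d, G d j ^ 2 = if j.1 ∈ T then 0 else streamShare N nbar p lam j) ∧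
      ∀ j j', j.1 ∉ T → streamShare N nbar p lam j = 1 → j' ≠ j →
        ∑ d, G d j * G d j' = 0 := by
  rcases hL.base_nonneg.eq_or_lt with h0 | h0
  · have hT : ∀ k, k ∈ T := fun k => by
      by_contra hk
      exact (hL.pos k).ne' ((hL.eq_base k hk).trans h0.symm)
    exact ⟨0, by simp [← h0], by simp [hT], by simp⟩
  · set f : (Σ k : Fin K, Fin (nbar k)) → ℝ :=
      fun j => if j.1 ∈ T then 0 else streamShare N nbar p lam j with hf
    have hsum : ∑ j, f j = Fintype.card (Fin D) := by
      rw [Fintype.sum_sigma, ← Finset.sum_add_sum_compl T, Finset.sum_eq_zero, zero_add]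
      · have : ∀ k ∈ Tᶜ, ∑ l, f ⟨k, l⟩ = N * p k / lam₀ := fun k hk => by
          have hk := Finset.mem_compl.1 hk
          simp only [hf, hk, if_false, streamShare]
          rw [sum_unitPart (hL.share_nonneg hp k) (hL.share_le k), hL.eq_base k hk]
        rw [Finset.sum_congr rfl this, ← Finset.sum_div, ← hL.energy_base,
          mul_div_cancel_left₀ _ h0.ne', Fintype.card_fin]
      · intro k hk
        simp [hf, hk]
    obtain ⟨G, hG, hGf⟩ := Matrix.exists_parseval_frame (κ := Fin D) f
      (fun j => by
        simp only [hf]; split_ifs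
        · exact le_rfl
        · exact unitPart_nonneg _ _)
      (fun j => by
        simp only [hf]; split_ifs
        · exact zero_le_one
        · exact unitPart_le_one _ _) hsum
    refine ⟨G, fun d d' => ?_, hGf, fun j j' hj hj1 hne => ?_⟩
    · have := congrFun (congrFun hG d) d'
      simp only [Matrix.mul_apply, Matrix.transpose_apply, Matrix.one_apply] at this
      rw [this]; simp
    · exact Matrix.sum_mul_eq_zero_of_parseval hG (by rw [hGf]; simp [hf, hj, hj1]) hne

theorem IsLevelProfile.exists_frame (hL : IsLevelProfile N D nbar p T lam lam₀)
    (hp : ∀ k, 0 < p k) :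
    ∃ H : Matrix (DimIndex D nbar T) (Σ k : Fin K, Fin (nbar k)) ℝ,
      (∀ r r', ∑ j, lam j.1 * (H r j * H r' j) = if r = r' then dimLevel lam lam₀ r else 0) ∧
      (∀ j, ∑ r, H r j ^ 2 = streamShare N nbar p lam j) ∧
      ∀ j j', streamShare N nbar p lam j = 1 → j' ≠ j → ∑ r, H r j * H r j' = 0 := by
  obtain ⟨G, hGG, hGf, hGo⟩ := hL.exists_base_frame hp
  have hG0 : ∀ j, j.1 ∈ T → ∀ d, G d j = 0 := fun j hj d => by
    have h := hGf j
    rw [if_pos hj] at h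
    exact pow_eq_zero_iff two_ne_zero |>.1
      ((Finset.sum_eq_zero_iff_of_nonneg fun d _ => sq_nonneg _).1 h d (Finset.mem_univ d))
  -- Each stream of a user in `T` gets a standard basis vector of its own; the other streams get the
  -- columns of `G`.
  let H : Matrix (DimIndex D nbar T) (Σ k : Fin K, Fin (nbar k)) ℝ :=
    Matrix.of fun r j => Sum.elim (fun a => if a.1 = j then 1 else 0) (fun d => G d j) r
  have hl : ∀ a j, H (Sum.inl a) j = if a.1 = j then 1 else 0 := fun _ _ => rfl
  have hr : ∀ d j, H (Sum.inr d) j = G d j := fun _ _ => rfl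
  refine ⟨H, ?_, fun j => ?_, fun j j' hj hne => ?_⟩
  · rintro (a | d) (b | d')
    · by_cases hab : a = b
      · subst hab
        simp [hl, dimLevel]
      · have hab' : a.1 ≠ b.1 := fun h => hab (Subtype.ext h)
        simp [hl, hab, hab']
    · simp [hl, hr, hG0 a.1 a.2]
    · simp [hl, hr, hG0 b.1 b.2]
    · have : ∀ j : Σ k : Fin K, Fin (nbar k), lam j.1 * (G d j * G d' j) =
          lam₀ * (G d j * G d' j) := fun j => by
        by_cases hj : j.1 ∈ T
        · simp [hG0 j hj]
        · rw [hL.eq_base _ hj]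
      simp only [hr, this, ← Finset.mul_sum, hGG, Sum.inr.injEq]
      rfl
  · rw [Fintype.sum_sum_type]
    simp only [hl, hr, hGf]
    by_cases hj : j.1 ∈ T
    · rw [if_pos hj, hL.streamShare_eq_one hj, Finset.sum_eq_single ⟨j, hj⟩]
      · simp
      · intro a _ ha
        have : a.1 ≠ j := fun h => ha (Subtype.ext h)
        simp [this]
      · simp
    · rw [if_neg hj, Finset.sum_eq_zero, zero_add]
      intro a _
      have : a.1 ≠ j := fun h => hj (h ▸ a.2)
      simp [this]
  · rw [Fintype.sum_sum_type]
    simp only [hl, hr]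
    rw [Finset.sum_eq_zero, zero_add]
    · by_cases hjT : j.1 ∈ T
      · simp [hG0 j hjT]
      · exact hGo j j' hjT hj hne
    · intro a _
      by_cases h : a.1 = j
      · have : a.1 ≠ j' := fun h' => hne (h'.symm.trans h)
        simp [this]
      · simp [h]

end Frame

namespace CDMASystem

open scoped Matrix

variable {K N D : ℕ} {nbar : Fin K → ℕ} {p : Fin K → ℝ} {T : Finset (Fin K)} {lam : Fin K → ℝ}
  {lam₀ : ℝ}

theorem exists_waterFilling (hN : 0 < N) (hL : IsLevelProfile N D nbar p T lam lam₀)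
    (hp : ∀ k, 0 < p k) (e : Fin N ≃ DimIndex D nbar T) :
    ∃ X : CDMASystem N nbar, X.IsFeasible p ∧ X.IsNormalized ∧
      ∑ k, X.userCov k = Matrix.diagonal (fun i => dimLevel lam lam₀ (e i)) ∧
      ∀ k, X.numActive k ≤ ⌈N * p k / lam k⌉₊ ∧ ⌊N * p k / lam k⌋₊ ≤ X.numOrthogonal k := by
  classical
  obtain ⟨H₀, hH₀, hf₀, ho₀⟩ := hL.exists_frame hp
  let H : Matrix (Fin N) (Σ k : Fin K, Fin (nbar k)) ℝ := H₀.submatrix e id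
  set f := streamShare N nbar p lam with hfdef
  have hH : ∀ i i', ∑ j, lam j.1 * (H i j * H i' j) =
      if i = i' then dimLevel lam lam₀ (e i) else 0 := fun i i' => by
    simpa [H] using hH₀ (e i) (e i')
  have hf : ∀ j, ∑ i, H i j ^ 2 = f j := fun j => by
    rw [← hf₀ j, ← e.sum_comp]; rfl
  have ho : ∀ j j', f j = 1 → j' ≠ j → ∑ i, H i j * H i j' = 0 := fun j j' hj hne => by
    rw [← ho₀ j j' hj hne, ← e.sum_comp]; rfl
  have hf0 : ∀ j, 0 ≤ f j := fun j => unitPart_nonneg _ _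
  have hH0 : ∀ j, f j = 0 → ∀ i, H i j = 0 := fun j hj i => by
    have h := hf j
    rw [hj] at h
    exact pow_eq_zero_iff two_ne_zero |>.1
      ((Finset.sum_eq_zero_iff_of_nonneg fun i _ => sq_nonneg _).1 h i (Finset.mem_univ i))
  have hNpos : (0 : ℝ) < N := by exact_mod_cast hN
  -- Columns are rescaled to energy `N` and the powers compensate. A stream of zero share has a zero
  -- column, so an arbitrary vector of energy `N` is used, with zero power.
  let X : CDMASystem N nbar :=
    { sig := fun k => Matrix.of fun i l =>
        if f ⟨k, l⟩ = 0 then (if i = ⟨0, hN⟩ then √N else 0)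
        else √N / √(f ⟨k, l⟩) * H i ⟨k, l⟩
      corr := fun k => Matrix.diagonal fun l => lam k * f ⟨k, l⟩ / N }
  have hsig : ∀ k i l, f ⟨k, l⟩ ≠ 0 → X.sig k i l = √N / √(f ⟨k, l⟩) * H i ⟨k, l⟩ :=
    fun k i l h => by simp [X, h]
  have hcorr : ∀ k l, X.corr k l l = lam k * f ⟨k, l⟩ / N := fun k l => by simp [X]
  have hact : ∀ k l, X.IsActive k l ↔ 0 < f ⟨k, l⟩ := fun k l => by
    rw [IsActive, hcorr, div_pos_iff_of_pos_right hNpos, mul_pos_iff_of_pos_left (hL.pos k)]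
  have hcov : ∀ k i i', X.userCov k i i' =
      ∑ l, lam k * (H i ⟨k, l⟩ * H i' ⟨k, l⟩) := fun k i i' => by
    rw [userCov, Matrix.mul_apply]
    refine Finset.sum_congr rfl fun l _ => ?_
    simp only [X, Matrix.mul_diagonal, Matrix.transpose_apply, Matrix.of_apply]
    by_cases h : f ⟨k, l⟩ = 0
    · simp [h, hH0 _ h]
    · have h1 : 0 < f ⟨k, l⟩ := lt_of_le_of_ne (hf0 _) (Ne.symm h)
      have h2 := Real.mul_self_sqrt h1.le
      have h3 := Real.mul_self_sqrt hNpos.le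
      have h4 := Real.sqrt_pos.2 h1
      simp only [h, if_false]
      field_simp
      rw [← sq] at h2 h3
      rw [h2, h3]
      ring
  have hfeas : X.IsFeasible p := fun k => by
    constructor
    · refine Matrix.PosSemidef.diagonal fun l => ?_
      have := hf0 ⟨k, l⟩
      have := hL.pos k
      simp only [Pi.zero_apply]
      positivity
    · have htr : (X.userCov k).trace = N * p k := by
        simp only [Matrix.trace, Matrix.diag_apply, hcov]
        rw [Finset.sum_comm]
        simp only [← Finset.mul_sum, ← sq, hf]
        simp only [hfdef, streamShare]
        rw [sum_unitPart (hL.share_nonneg hp k) (hL.share_le k),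
          mul_div_cancel₀ _ (hL.pos k).ne']
      rw [userCov] at htr
      rw [htr]
      field_simp
  refine ⟨X, hfeas, fun k => ⟨Matrix.isDiag_diagonal _, fun l => ?_⟩, ?_, fun k => ⟨?_, ?_⟩⟩
  · by_cases h : f ⟨k, l⟩ = 0
    · simp [X, h, ite_pow]
    · have h1 : 0 < f ⟨k, l⟩ := lt_of_le_of_ne (hf0 _) (Ne.symm h)
      simp only [hsig k _ l h, mul_pow, ← Finset.mul_sum, hf, div_pow, Real.sq_sqrt h1.le,
        Real.sq_sqrt hNpos.le]
      field_simp
  · ext i i'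
    rw [Matrix.sum_apply, Matrix.diagonal_apply, ← hH, Fintype.sum_sigma]
    exact Finset.sum_congr rfl fun k _ => hcov k i i'
  · rw [numActive, Set.ncard_eq_toFinset_card']
    refine (Finset.card_le_card_of_injOn (t := Finset.range ⌈N * p k / lam k⌉₊)
      (fun l => l.val) (fun l hl => ?_) Fin.val_injective.injOn).trans_eq
      (Finset.card_range _)
    have : X.IsActive k l := by simpa using hl
    rw [hact] at this
    simpa using unitPart_pos_iff.1 this
  · have hle : ⌊N * p k / lam k⌋₊ ≤ nbar k :=
      (Nat.floor_le_floor (hL.share_le k)).trans_eq (Nat.floor_natCast _)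
    rw [numOrthogonal, Set.ncard_eq_toFinset_card']
    refine le_trans (le_of_eq ?_) (Finset.card_le_card
      (s := Finset.univ.map (Fin.castLEEmb hle)) fun l hl => ?_)
    · simp
    · obtain ⟨a, -, rfl⟩ := Finset.mem_map.1 hl
      have h1 : f ⟨k, Fin.castLEEmb hle a⟩ = 1 := unitPart_eq_one a.2
      set l := Fin.castLEEmb hle a
      have hne : f ⟨k, l⟩ ≠ 0 := by rw [h1]; exact one_ne_zero
      rw [Set.mem_toFinset]
      refine ⟨(hact k l).2 (by rw [h1]; exact one_pos), fun h0 => ?_, fun k' l' hl' hkl => ?_⟩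
      · have hz : ∑ i, H i ⟨k, l⟩ ^ 2 = 0 := Finset.sum_eq_zero fun i _ => by
          have h := congrFun h0 i
          rw [Matrix.col_apply, hsig k i l hne, h1] at h
          simpa [hN.ne'] using h
        rw [hf, h1] at hz
        exact one_ne_zero hz
      · have hne' : f ⟨k', l'⟩ ≠ 0 := ((hact k' l').1 hl').ne'
        simp only [dotProduct, Matrix.col_apply, hsig k _ l hne, hsig k' _ l' hne']
        have h2 := ho ⟨k, l⟩ ⟨k', l'⟩ h1 hkl
        calc _ = ∑ i, (√N / √(f ⟨k, l⟩)) * (√N / √(f ⟨k', l'⟩)) *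
              (H i ⟨k, l⟩ * H i ⟨k', l'⟩) := Finset.sum_congr rfl fun i _ => by ring
          _ = 0 := by rw [← Finset.mul_sum, h2, mul_zero]

theorem sumRate_le_iff (hN : 0 < N) {X Y : CDMASystem N nbar} (hX : X.IsFeasible p)
    (hY : Y.IsFeasible p) {σ : ℝ} (hσ : 0 < σ) :
    X.sumRate σ ≤ Y.sumRate σ ↔
      (1 + (1 / σ ^ 2) • ∑ k, X.userCov k).det ≤ (1 + (1 / σ ^ 2) • ∑ k, Y.userCov k).det := by
  have hNpos : (0 : ℝ) < N := by exact_mod_cast hN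
  rw [sumRate, sumRate, sigMatrix_mul_corrMatrix_mul, sigMatrix_mul_corrMatrix_mul,
    mul_le_mul_iff_right₀ (by positivity),
    Real.logb_le_logb one_lt_two (hX.one_add_posDef hσ).det_pos (hY.one_add_posDef hσ).det_pos]

theorem optimal_of_levelProfile (hN : 0 < N) (hL : IsLevelProfile N D nbar p T lam lam₀)
    (hp : ∀ k, 0 < p k) {σ : ℝ} (hσ : 0 < σ) :
    (∀ X : CDMASystem N nbar, X.IsSumRateOptimal p σ → ∀ k,
      ⌈N * p k / lam k⌉₊ ≤ X.numActive k ∧ X.numOrthogonal k ≤ ⌊N * p k / lam k⌋₊) ∧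
    ∃ X : CDMASystem N nbar, X.IsSumRateOptimal p σ ∧ X.IsNormalized ∧
      ∀ k, X.numActive k = ⌈N * p k / lam k⌉₊ ∧ X.numOrthogonal k = ⌊N * p k / lam k⌋₊ := by
  obtain ⟨e, he⟩ := exists_equiv_antitone hL.card_dimIndex (dimLevel lam lam₀)
  obtain ⟨X, hX, hXn, hXM, hXk⟩ := exists_waterFilling hN hL hp e
  have hdet : (1 + (1 / σ ^ 2) • ∑ k, X.userCov k).det =
      ∏ i, (1 + dimLevel lam lam₀ (e i) / σ ^ 2) := by
    rw [hXM, ← Matrix.diagonal_one, ← Matrix.diagonal_smul, Matrix.diagonal_add,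
      Matrix.det_diagonal]
    exact Finset.prod_congr rfl fun i _ => by simp; ring
  have hXo : X.IsSumRateOptimal p σ := ⟨hX, fun Y hY => by
    rw [sumRate_le_iff hN hY hX hσ, hdet]
    exact (hY.det_le hN hL hσ e he).1⟩
  have hbound : ∀ Y : CDMASystem N nbar, Y.IsSumRateOptimal p σ → ∀ k,
      ⌈N * p k / lam k⌉₊ ≤ Y.numActive k ∧ Y.numOrthogonal k ≤ ⌊N * p k / lam k⌋₊ := by
    intro Y hY k
    have hle := hY.2 X hX
    rw [sumRate_le_iff hN hX hY.1 hσ, hdet] at hle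
    obtain ⟨Q, hQ⟩ := (hY.1.det_le hN hL hσ e he).2 hle
    constructor
    · rw [Nat.ceil_le, div_le_iff₀ (hL.pos k), mul_comm _ (lam k)]
      exact hQ.energy_le hN hY.1 hL.pos k
    · by_cases hk : k ∈ T
      · rw [hL.share_eq hk, Nat.floor_natCast, numOrthogonal]
        exact (Set.ncard_le_card _).trans_eq (by simp)
      · apply Nat.le_floor
        rw [le_div_iff₀ (hL.pos k), mul_comm _ (lam k)]
        refine hQ.le_energy hN hY.1 (fun i => ?_) k
        have := dimLevel_ge hL (e i)
        have := hL.pos k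
        rw [hL.eq_base k hk] at this
        linarith
  exact ⟨hbound, X, hXo, hXn, fun k => ⟨le_antisymm (hXk k).1 (hbound X hXo k).1,
    le_antisymm (hbound X hXo k).2 (hXk k).2⟩⟩

end CDMASystem

/-! ### Sizing of users and existence of the level profile. -/

theorem IsLowerSet.mem_iff_val_lt_ncard {K : ℕ} {S : Set (Fin K)} (hS : IsLowerSet S)
    (k : Fin K) : k ∈ S ↔ k.val < S.ncard := by
  constructor
  · intro hk
    have hsub : Set.Iic k ⊆ S := fun j hj => hS hj hk
    have h := Set.ncard_le_ncard hsub
    rw [← Finset.coe_Iic, Set.ncard_coe_finset, Fin.card_Iic] at h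
    omega
  · intro h
    by_contra hk
    have hsub : S ⊆ Set.Iio k := fun j hj => not_le.1 fun hkj => hk (hS hkj hj)
    have h' := Set.ncard_le_ncard hsub
    rw [← Finset.coe_Iio, Set.ncard_coe_finset, Fin.card_Iio] at h'
    omega

section Sizing

variable {K N : ℕ} {nbar : Fin K → ℕ} {p : Fin K → ℝ}

theorem le_nhat_iff (hp : ∀ k, 0 < p k) (k : Fin K) :
    (nbar k : ℝ) ≤ nhat N nbar p k ↔
      (nbar k : ℝ) * ∑ k' ∈ Finset.Ici k, p k' ≤
        ((N : ℝ) - ∑ k' ∈ Finset.Iio k, (nbar k' : ℝ)) * p k := by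
  rw [nhat, ← mul_div_assoc, le_div_iff₀ (Finset.sum_pos (fun k _ => hp k) ⟨k, by simp⟩)]

/-- This makes the count `numNonUndersized` a threshold on indices. If `j` is undersized, removing
the users from `j` to `k - 1`, each with power at most `p j / nbar j` per stream, keeps the strict
inequality, and `k` has no larger ratio than `j`. -/
theorem isLowerSet_nonUndersized (hnbar : ∀ k, 1 ≤ nbar k) (hp : ∀ k, 0 < p k)
    (hord : ∀ i j : Fin K, i ≤ j → p j / (nbar j : ℝ) ≤ p i / (nbar i : ℝ)) :
    IsLowerSet {k : Fin K | (nbar k : ℝ) ≤ nhat N nbar p k} := by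
  intro k j hjk hk
  by_contra hj
  rw [Set.mem_ofPred_eq, le_nhat_iff hp] at hk hj
  have hn : ∀ k, (0 : ℝ) < nbar k := fun k => by exact_mod_cast hnbar k
  have hB : ∑ i ∈ Finset.Iio k, (nbar i : ℝ) =
      ∑ i ∈ Finset.Iio j, (nbar i : ℝ) + ∑ i ∈ Finset.Ico j k, (nbar i : ℝ) := by
    rw [← Finset.sum_union (Finset.disjoint_left.2 fun i hi hi' =>
      absurd (Finset.mem_Ico.1 hi').1 (not_le.2 (Finset.mem_Iio.1 hi)))]
    congr 1; ext i; simp only [Finset.mem_union, Finset.mem_Iio, Finset.mem_Ico]; omega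
  have hP : ∑ i ∈ Finset.Ici j, p i =
      ∑ i ∈ Finset.Ico j k, p i + ∑ i ∈ Finset.Ici k, p i := by
    rw [← Finset.sum_union (Finset.disjoint_left.2 fun i hi hi' =>
      absurd (Finset.mem_Ici.1 hi') (not_le.2 (Finset.mem_Ico.1 hi).2))]
    congr 1; ext i; simp only [Finset.mem_union, Finset.mem_Ici, Finset.mem_Ico]; omega
  set t := p j / nbar j with ht
  have hpj : p j = t * nbar j := (div_mul_cancel₀ _ (hn j).ne').symm
  have hIco : ∑ i ∈ Finset.Ico j k, p i ≤ t * ∑ i ∈ Finset.Ico j k, (nbar i : ℝ) := by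
    rw [Finset.mul_sum]
    exact Finset.sum_le_sum fun i hi => (div_le_iff₀ (hn i)).1 (hord j i (Finset.mem_Ico.1 hi).1)
  have h1 : ((N : ℝ) - ∑ i ∈ Finset.Iio j, (nbar i : ℝ)) * t < ∑ i ∈ Finset.Ici j, p i := by
    rw [not_le, hpj] at hj
    have hnj := hn j
    refine lt_of_mul_lt_mul_left ?_ hnj.le
    linarith
  have h2 : t * ((N : ℝ) - ∑ i ∈ Finset.Iio k, (nbar i : ℝ)) < ∑ i ∈ Finset.Ici k, p i := by
    rw [hB]; rw [hP] at h1; linarith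
  have hPk : 0 < ∑ i ∈ Finset.Ici k, p i := Finset.sum_pos (fun k _ => hp k) ⟨k, by simp⟩
  have hpk : p k ≤ t * nbar k := (div_le_iff₀ (hn k)).1 (hord j k hjk)
  set C := (N : ℝ) - ∑ i ∈ Finset.Iio k, (nbar i : ℝ)
  -- With no dimensions left, `k` is undersized by sign alone; otherwise the bound `hpk` can be
  -- multiplied by `C`.
  rcases le_total C 0 with hC | hC
  · have := mul_pos (hn k) hPk
    have := mul_nonneg_of_nonpos_of_nonpos hC (neg_nonpos.2 (hp k).le)
    linarith
  · have h3 := mul_le_mul_of_nonneg_left hpk hC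
    have h4 := mul_lt_mul_of_pos_left h2 (hn k)
    linarith

/-- The users that are not undersized. -/
noncomputable def tightUsers (N : ℕ) (nbar : Fin K → ℕ) (p : Fin K → ℝ) : Finset (Fin K) :=
  Finset.univ.filter fun k => k.val < numNonUndersized N nbar p

theorem mem_tightUsers {k : Fin K} :
    k ∈ tightUsers N nbar p ↔ k.val < numNonUndersized N nbar p := by
  simp [tightUsers]

theorem undersizedShare_eq (k : Fin K) :
    undersizedShare N nbar p k =
      ((N : ℝ) - ∑ k' ∈ tightUsers N nbar p, (nbar k' : ℝ)) *
        (p k / ∑ k' ∈ (tightUsers N nbar p)ᶜ, p k') := by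
  rw [undersizedShare]
  congr 3
  ext i; simp [tightUsers]

/-- The cross-multiplied form of `lam₀ ≤ lam k`. By the ordering it suffices to treat the last
non-undersized user `m`, for which the terms `nbar m * p m` cancel from the defining inequality. -/
theorem base_le_of_mem_tightUsers (hnbar : ∀ k, 1 ≤ nbar k) (hp : ∀ k, 0 < p k)
    (hord : ∀ i j : Fin K, i ≤ j → p j / (nbar j : ℝ) ≤ p i / (nbar i : ℝ))
    {k : Fin K} (hk : k ∈ tightUsers N nbar p) :
    (nbar k : ℝ) * ∑ k' ∈ (tightUsers N nbar p)ᶜ, p k' ≤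
      ((N : ℝ) - ∑ k' ∈ tightUsers N nbar p, (nbar k' : ℝ)) * p k := by
  have hn : ∀ k, (0 : ℝ) < nbar k := fun k => by exact_mod_cast hnbar k
  have hS := isLowerSet_nonUndersized (N := N) hnbar hp hord
  set T := tightUsers N nbar p with hT
  have hkT := mem_tightUsers.1 hk
  have hK2 : numNonUndersized N nbar p ≤ K := (Set.ncard_le_card _).trans_eq (by simp)
  let m : Fin K := ⟨numNonUndersized N nbar p - 1, by omega⟩
  have hm : m ∈ {k : Fin K | (nbar k : ℝ) ≤ nhat N nbar p k} := by
    rw [hS.mem_iff_val_lt_ncard]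
    change numNonUndersized N nbar p - 1 < numNonUndersized N nbar p
    omega
  rw [Set.mem_ofPred_eq, le_nhat_iff hp] at hm
  have hkm : k ≤ m := by
    rw [Fin.le_def]; change k.val ≤ numNonUndersized N nbar p - 1; omega
  have hmT : ∀ i, i ∈ T ↔ i ≤ m := fun i => by
    rw [mem_tightUsers, Fin.le_def]
    change _ ↔ i.val ≤ numNonUndersized N nbar p - 1
    omega
  have hTm : T = insert m (Finset.Iio m) := by
    ext i; rw [hmT, Finset.mem_insert, Finset.mem_Iio, le_iff_eq_or_lt]
  have hIci : Finset.Ici m = insert m Tᶜ := by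
    ext i
    rw [Finset.mem_Ici, Finset.mem_insert, Finset.mem_compl, hmT, not_le, le_iff_eq_or_lt, eq_comm]
  have hBT : ∑ i ∈ T, (nbar i : ℝ) = nbar m + ∑ i ∈ Finset.Iio m, (nbar i : ℝ) := by
    rw [hTm, Finset.sum_insert (by simp)]
  rw [hIci, Finset.sum_insert (by simp [hmT])] at hm
  have hP : 0 ≤ ∑ i ∈ Tᶜ, p i := Finset.sum_nonneg fun i _ => (hp i).le
  have h1 : (nbar m : ℝ) * ∑ i ∈ Tᶜ, p i ≤ ((N : ℝ) - ∑ i ∈ T, (nbar i : ℝ)) * p m := by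
    rw [hBT]; linarith
  have h2 : 0 ≤ (N : ℝ) - ∑ i ∈ T, (nbar i : ℝ) :=
    nonneg_of_mul_nonneg_left ((mul_nonneg (hn m).le hP).trans h1) (hp m)
  have h3 := hord k m hkm
  rw [div_le_div_iff₀ (hn m) (hn k)] at h3
  have h4 := mul_le_mul_of_nonneg_left h1 (hn k).le
  have h5 := mul_le_mul_of_nonneg_left h3 h2
  refine le_of_mul_le_mul_left ?_ (hn m)
  linarith

/-- This ensures that an undersized user's share fits into its `nbar k` streams. For the first
undersized user it is the failure of the defining inequality, and the ordering carries it to later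
ones. -/
theorem le_base_of_notMem_tightUsers (hnbar : ∀ k, 1 ≤ nbar k) (hp : ∀ k, 0 < p k)
    (hord : ∀ i j : Fin K, i ≤ j → p j / (nbar j : ℝ) ≤ p i / (nbar i : ℝ))
    (hdim : 0 ≤ (N : ℝ) - ∑ k' ∈ tightUsers N nbar p, (nbar k' : ℝ))
    {k : Fin K} (hk : k ∉ tightUsers N nbar p) :
    ((N : ℝ) - ∑ k' ∈ tightUsers N nbar p, (nbar k' : ℝ)) * p k ≤
      (nbar k : ℝ) * ∑ k' ∈ (tightUsers N nbar p)ᶜ, p k' := by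
  have hn : ∀ k, (0 : ℝ) < nbar k := fun k => by exact_mod_cast hnbar k
  have hS := isLowerSet_nonUndersized (N := N) hnbar hp hord
  set T := tightUsers N nbar p with hT
  have hkT := mt mem_tightUsers.2 hk
  let m : Fin K := ⟨numNonUndersized N nbar p, by omega⟩
  have hm : m ∉ {k : Fin K | (nbar k : ℝ) ≤ nhat N nbar p k} := by
    rw [hS.mem_iff_val_lt_ncard]
    change ¬ numNonUndersized N nbar p < numNonUndersized N nbar p
    omega
  rw [Set.mem_ofPred_eq, le_nhat_iff hp, not_le] at hm
  have hmk : m ≤ k := by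
    rw [Fin.le_def]; change numNonUndersized N nbar p ≤ k.val; omega
  have hTm : Finset.Iio m = T := by
    ext i; rw [mem_tightUsers, Finset.mem_Iio, Fin.lt_def]
  have hIci : Finset.Ici m = Tᶜ := by
    ext i; rw [Finset.mem_Ici, Finset.mem_compl, ← hTm, Finset.mem_Iio, not_lt]
  rw [hIci, hTm] at hm
  have h3 := hord m k hmk
  rw [div_le_div_iff₀ (hn k) (hn m)] at h3
  have h4 := mul_lt_mul_of_pos_left hm (hn k)
  have h5 := mul_le_mul_of_nonneg_left h3 hdim
  refine le_of_mul_le_mul_left ?_ (hn m)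
  linarith

theorem exists_levelProfile (hN : 0 < N) (hnbar : ∀ k, 1 ≤ nbar k) (hp : ∀ k, 0 < p k)
    (hord : ∀ i j : Fin K, i ≤ j → p j / (nbar j : ℝ) ≤ p i / (nbar i : ℝ)) :
    ∃ (D : ℕ) (lam : Fin K → ℝ) (lam₀ : ℝ),
      IsLevelProfile N D nbar p (tightUsers N nbar p) lam lam₀ ∧
        ∀ k ∉ tightUsers N nbar p, N * p k / lam k = undersizedShare N nbar p k := by
  have hn : ∀ k, (0 : ℝ) < nbar k := fun k => by exact_mod_cast hnbar k
  have hNpos : (0 : ℝ) < N := by exact_mod_cast hN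
  have hmem := fun k => base_le_of_mem_tightUsers (N := N) hnbar hp hord (k := k)
  have hnot := fun h k => le_base_of_notMem_tightUsers (N := N) hnbar hp hord h (k := k)
  have hshare := undersizedShare_eq (N := N) (nbar := nbar) (p := p)
  set T := tightUsers N nbar p with hT
  set P := ∑ k ∈ Tᶜ, p k with hP
  have hP0 : 0 ≤ P := Finset.sum_nonneg fun i _ => (hp i).le
  have hdim : 0 ≤ (N : ℝ) - ∑ k ∈ T, (nbar k : ℝ) := by
    rcases T.eq_empty_or_nonempty with h | ⟨k, hk⟩
    · rw [h]; simp
    · exact nonneg_of_mul_nonneg_left ((mul_nonneg (hn k).le hP0).trans (hmem k hk)) (hp k)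
  have hdim' : 0 < P → 0 < (N : ℝ) - ∑ k ∈ T, (nbar k : ℝ) := fun h => by
    rcases T.eq_empty_or_nonempty with h | ⟨k, hk⟩
    · rw [h]; simpa using hN
    · exact pos_of_mul_pos_left ((mul_pos (hn k) h).trans_le (hmem k hk)) (hp k).le
  have hBN : ∑ k ∈ T, nbar k ≤ N := by
    have := sub_nonneg.1 hdim
    exact_mod_cast this
  obtain ⟨D, hD⟩ := Nat.exists_eq_add_of_le hBN
  have hDr : (N : ℝ) - ∑ k ∈ T, (nbar k : ℝ) = D := by
    rw [hD]; push_cast; ring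
  rw [hDr] at hdim hdim' hmem hnot hshare
  have hPpos : ∀ k, k ∉ T → 0 < P := fun k hk =>
    Finset.sum_pos (fun i _ => hp i) ⟨k, Finset.mem_compl.2 hk⟩
  -- If `D = 0`, then `hdim'` gives `P = 0`: all users are tight, and the default value 0 of the
  -- division is the level wanted.
  set lam₀ : ℝ := N * P / D with hlam₀
  have hlam₀0 : 0 ≤ lam₀ := by positivity
  have hlam₀pos : ∀ k, k ∉ T → 0 < lam₀ := fun k hk => by
    have := hPpos k hk
    have := hdim' this
    positivity
  set lam : Fin K → ℝ := fun k => if k ∈ T then N * p k / nbar k else lam₀ with hlam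
  have hlT : ∀ k, k ∈ T → lam k = N * p k / nbar k := fun k hk => by simp [hlam, hk]
  have hlN : ∀ k, k ∉ T → lam k = lam₀ := fun k hk => by simp [hlam, hk]
  refine ⟨D, lam, lam₀, ⟨hD.symm, fun k => ?_, hlam₀0, fun k => ?_, hlN, fun k hk => ?_, ?_,
    fun k => ?_⟩, fun k hk => ?_⟩
  · by_cases hk : k ∈ T
    · rw [hlT k hk]
      have := hn k
      have := hp k
      positivity
    · rw [hlN k hk]; exact hlam₀pos k hk
  · by_cases hk : k ∈ T
    · rw [hlT k hk]
      rcases hdim.eq_or_lt with h | h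
      · rw [hlam₀, ← h, div_zero]
        have := hn k
        have := hp k
        positivity
      · rw [hlam₀, div_le_div_iff₀ h (hn k)]
        have := mul_le_mul_of_nonneg_left (hmem k hk) hNpos.le
        linarith
    · rw [hlN k hk]
  · rw [hlT k hk, div_mul_cancel₀ _ (hn k).ne']
  · rw [← Finset.mul_sum, ← hP]
    rcases hP0.eq_or_lt with h | h
    · rw [hlam₀, ← h]; simp
    · rw [hlam₀, div_mul_cancel₀ _ (hdim' h).ne']
  · by_cases hk : k ∈ T
    · rw [hlT k hk, div_mul_cancel₀ _ (hn k).ne']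
    · have h := hdim' (hPpos k hk)
      rw [hlN k hk, hlam₀, div_mul_eq_mul_div, le_div_iff₀ h]
      have := mul_le_mul_of_nonneg_left (hnot hdim k hk) hNpos.le
      linarith
  · have h1 := hPpos k hk
    have h2 := hdim' h1
    rw [hlN k hk, hlam₀, hshare]
    field_simp

end Sizing

theorem theorem6 {K N : ℕ} (hN : 0 < N) (nbar : Fin K → ℕ) (hnbar : ∀ k, 1 ≤ nbar k)
    (p : Fin K → ℝ) (hp : ∀ k, 0 < p k) (σ : ℝ) (hσ : 0 < σ)
    (hord : ∀ i j : Fin K, i ≤ j → p j / (nbar j : ℝ) ≤ p i / (nbar i : ℝ)) :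
    -- the minimum number of active signature sequences of each user
    (∀ k : Fin K,
      (k.val < numNonUndersized N nbar p →
        IsLeast {n : ℕ | ∃ X : CDMASystem N nbar, X.IsSumRateOptimal p σ ∧ X.numActive k = n}
          (nbar k)) ∧
      (numNonUndersized N nbar p ≤ k.val →
        IsLeast {n : ℕ | ∃ X : CDMASystem N nbar, X.IsSumRateOptimal p σ ∧ X.numActive k = n}
          ⌈undersizedShare N nbar p k⌉₊)) ∧
    -- the maximum number of active orthogonal signature sequences of each user
    (∀ k : Fin K,
      (k.val < numNonUndersized N nbar p →
        IsGreatest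
          {n : ℕ | ∃ X : CDMASystem N nbar, X.IsSumRateOptimal p σ ∧ X.numOrthogonal k = n}
          (nbar k)) ∧
      (numNonUndersized N nbar p ≤ k.val →
        IsGreatest
          {n : ℕ | ∃ X : CDMASystem N nbar, X.IsSumRateOptimal p σ ∧ X.numOrthogonal k = n}
          ⌊undersizedShare N nbar p k⌋₊)) ∧
    -- one optimal system, in normalized form, attains all these minima and maxima
    ∃ X : CDMASystem N nbar, X.IsSumRateOptimal p σ ∧ X.IsNormalized ∧
      ∀ k : Fin K,
        (k.val < numNonUndersized N nbar p →
          X.numActive k = nbar k ∧ X.numOrthogonal k = nbar k) ∧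
        (numNonUndersized N nbar p ≤ k.val →
          X.numActive k = ⌈undersizedShare N nbar p k⌉₊ ∧
          X.numOrthogonal k = ⌊undersizedShare N nbar p k⌋₊) := by
  obtain ⟨D, lam, lam₀, hL, hshare⟩ := exists_levelProfile (N := N) hN hnbar hp hord
  obtain ⟨hbound, X, hX, hXn, hXk⟩ := CDMASystem.optimal_of_levelProfile hN hL hp hσ
  have htight : ∀ k : Fin K, k.val < numNonUndersized N nbar p →
      N * p k / lam k = nbar k := fun k hk => hL.share_eq (mem_tightUsers.2 hk)
  have hunder : ∀ k : Fin K, numNonUndersized N nbar p ≤ k.val →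
      N * p k / lam k = undersizedShare N nbar p k := fun k hk =>
    hshare k fun h => absurd (mem_tightUsers.1 h) (not_lt.2 hk)
  have hleast : ∀ k, IsLeast
      {n : ℕ | ∃ X : CDMASystem N nbar, X.IsSumRateOptimal p σ ∧ X.numActive k = n}
      ⌈N * p k / lam k⌉₊ := fun k =>
    ⟨⟨X, hX, (hXk k).1⟩, fun n ⟨Y, hY, hn⟩ => hn ▸ (hbound Y hY k).1⟩
  have hgreatest : ∀ k, IsGreatest
      {n : ℕ | ∃ X : CDMASystem N nbar, X.IsSumRateOptimal p σ ∧ X.numOrthogonal k = n}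
      ⌊N * p k / lam k⌋₊ := fun k =>
    ⟨⟨X, hX, (hXk k).2⟩, fun n ⟨Y, hY, hn⟩ => hn ▸ (hbound Y hY k).2⟩
  refine ⟨fun k => ⟨fun hk => ?_, fun hk => ?_⟩, fun k => ⟨fun hk => ?_, fun hk => ?_⟩,
    X, hX, hXn, fun k => ⟨fun hk => ?_, fun hk => ?_⟩⟩
  · simpa [htight k hk] using hleast k
  · simpa [hunder k hk] using hleast k
  · simpa [htight k hk] using hgreatest k
  · simpa [hunder k hk] using hgreatest k
  · simpa [htight k hk] using hXk k
  · simpa [hunder k hk] using hXk k
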